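/- Let $a,b,s\in\mathbb{R}$ with $s\neq 0$. Let $\mathcal H^0=L^2(0,1)\times L^2(0,1)$ be the real Hilbert space with inner product $\langle (f_1,g_1),(f_2,g_2)\rangle=\int_0^1 (f_1f_2+g_1g_2)\,dx$, and let $\mathcal A$ be the unbounded operator on $\mathcal H^0$ given by $$\mathcal A(f,g)=(f''+af,\;g''+bg),\qquad D(\mathcal A)=\{(f,g)\in H^2(0,1)\times H^2(0,1)\;:\; f(1)=g'(0)=g'(1)=0,\ f'(0)=s\,g(0)\}.$$ For $n,m\in\mathbb{N}=\{0,1,2,\dots\}$ put $\lambda_{1,n}=a-(n+\tfrac12)^2\pi^2$ and $\lambda_{2,m}=b-m^2\pi^2$. Let $\Delta(a,b)=\{(n,m)\in\mathbb{N}^2: 4(b-a)=(4m^2-(2n+1)^2)\pi^2\}$ and $\Delta_2(a,b)=\{m\in\mathbb N:\exists n\in\mathbb N,\ (n,m)\in\Delta(a,b)\}$; for $m\in\Delta_2(a,b)$ the integer $k$ with $(k,m)\in\Delta(a,b)$ is unique. Define $\phi_{1,n}(x)=\big(\sqrt2\cos((n+\tfrac12)\pi x),\,0\big)$ and $\phi_{2,m}=(\phi_{2,m}^1,\phi_{2,m}^2)$,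 where $\phi_{2,0}^2(x)=1$, $\phi_{2,m}^2(x)=\sqrt2\cos(m\pi x)$ for $m\ge1$, $\mu_m=\phi_{2,m}^2(0)$, and - if $m\notin\Delta_2(a,b)$ and $b-a=m^2\pi^2$: $\phi_{2,m}^1(x)=s\mu_m(x-1)$; - if $m\notin\Delta_2(a,b)$ and $b-a\neq m^2\pi^2$: $\phi_{2,m}^1(x)=-\dfrac{s\mu_m}{r_m\cosh r_m}\sinh(r_m(1-x))$, where $r_m\in\mathbb{C}$ is a square root of $b-a-m^2\pi^2$ (this function is real-valued and does not depend on the choice of the square root); - if $m\in\Delta_2(a,b)$ and $k$ is the integer with $(k,m)\in\Delta(a,b)$: $\phi_{2,m}^1(x)=\dfrac{s\mu_m}{(k+1/2)\pi}(1-x)\sin((k+\tfrac12)\pi x)$. Then each $\phi_{1,n}$ and each $\phi_{2,m}$ is a generalized eigenvector of $\mathcal A$, associated with $\lambda_{1,n}$ and $\lambda_{2,m}$ respectively, and the family $\Phi=\{\phi_{1,n}\}_{n\ge0}\cup\{\phi_{2,m}\}_{m\ge0}$ is a Riesz basis of $\mathcal H^0$, i.e. the image of an orthonormal Hilbert basis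 under a bounded, boundedly invertible linear operator of $\mathcal H^0$. Moreover, $\mathcal A$ is the infinitesimal generator of a $C_0$-semigroup on $\mathcal H^0$. -/

import Mathlib

open MeasureTheory Filter Topology Set
open scoped ContDiff NNReal

noncomputable section

namespace HeatCascade

/-! ### Function spaces on `(0,1)` -/

/-- Lebesgue measure on `(0,1)`. -/
abbrev mu01 : Measure ℝ := volume.restrict (Ioo (0 : ℝ) 1)

/-- The real Hilbert space `L²(0,1)`. -/
abbrev L2 : Type := Lp ℝ 2 mu01

/-- The real Hilbert space `L²(0,1) × L²(0,1)`, whose inner product is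
`⟨(f₁,g₁),(f₂,g₂)⟩ = ∫₀¹ (f₁ f₂ + g₁ g₂) dx`. -/
abbrev H0 : Type := WithLp 2 (L2 × L2)

theorem inner_H0 (u v : H0) :
    inner ℝ u v = ∫ x in Ioo (0 : ℝ) 1, (u.fst x * v.fst x + u.snd x * v.snd x) := by
  have key : ∀ f g : L2, Integrable (fun x => f x * g x) mu01 := fun f g => by
    have := L2.integrable_inner (𝕜 := ℝ) g f
    simpa using this
  rw [integral_add (key _ _) (key _ _), WithLp.prod_inner_apply]
  simp [L2.inner_def, mul_comm]

/-- `g` is the weak (distributional) derivative of `f` on `(0,1)`. -/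
def IsWeakDeriv (f g : L2) : Prop :=
  ∀ φ : ℝ → ℝ, ContDiff ℝ ∞ φ → HasCompactSupport φ → tsupport φ ⊆ Ioo (0 : ℝ) 1 →
    ∫ x in Ioo (0 : ℝ) 1, f x * deriv φ x = -∫ x in Ioo (0 : ℝ) 1, g x * φ x

theorem integrable_mul (f : L2) {φ : ℝ → ℝ} (hφ : Continuous φ) (hc : HasCompactSupport φ) :
    Integrable (fun x => f x * φ x) mu01 :=
  MemLp.integrable_mul (p := 2) (q := 2) (Lp.memLp f) (hφ.memLp_of_hasCompactSupport hc)

theorem IsWeakDeriv.add {f g f' g' : L2} (hf : IsWeakDeriv f f') (hg : IsWeakDeriv g g') :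
    IsWeakDeriv (f + g) (f' + g') := by
  intro φ h1 h2 h3
  have hd : Continuous (deriv φ) := h1.continuous_deriv (by simp)
  have e1 : (fun x => (f + g : L2) x * deriv φ x) =ᵐ[mu01]
      fun x => f x * deriv φ x + g x * deriv φ x := by
    filter_upwards [Lp.coeFn_add f g] with x hx
    rw [hx, Pi.add_apply, add_mul]
  have e2 : (fun x => (f' + g' : L2) x * φ x) =ᵐ[mu01]
      fun x => f' x * φ x + g' x * φ x := by
    filter_upwards [Lp.coeFn_add f' g'] with x hx
    rw [hx, Pi.add_apply, add_mul]
  rw [integral_congr_ae e1, integral_congr_ae e2,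
    integral_add (integrable_mul f hd h2.deriv) (integrable_mul g hd h2.deriv),
    integral_add (integrable_mul f' h1.continuous h2) (integrable_mul g' h1.continuous h2),
    hf φ h1 h2 h3, hg φ h1 h2 h3]
  ring

theorem IsWeakDeriv.smul (c : ℝ) {f f' : L2} (hf : IsWeakDeriv f f') :
    IsWeakDeriv (c • f) (c • f') := by
  intro φ h1 h2 h3
  have e1 : (fun x => (c • f : L2) x * deriv φ x) =ᵐ[mu01] fun x => c * (f x * deriv φ x) := by
    filter_upwards [Lp.coeFn_smul c f] with x hx
    rw [hx, Pi.smul_apply, smul_eq_mul, mul_assoc]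
  have e2 : (fun x => (c • f' : L2) x * φ x) =ᵐ[mu01] fun x => c * (f' x * φ x) := by
    filter_upwards [Lp.coeFn_smul c f'] with x hx
    rw [hx, Pi.smul_apply, smul_eq_mul, mul_assoc]
  rw [integral_congr_ae e1, integral_congr_ae e2, integral_const_mul, integral_const_mul,
    hf φ h1 h2 h3]
  ring

theorem isWeakDeriv_zero : IsWeakDeriv 0 0 := by
  have h : ∀ ψ : ℝ → ℝ, (fun x => (0 : L2) x * ψ x) =ᵐ[mu01] fun _ => 0 := fun ψ => by
    filter_upwards [Lp.coeFn_zero ℝ 2 mu01] with x hx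
    rw [hx, Pi.zero_apply, zero_mul]
  intro φ _ _ _
  rw [integral_congr_ae (h _), integral_congr_ae (h _)]
  simp

/-- The weak derivative is unique. -/
theorem IsWeakDeriv.unique {f g g' : L2} (h : IsWeakDeriv f g) (h' : IsWeakDeriv f g') :
    g = g' := by
  have hint : Integrable (fun x => (g x - g' x)) mu01 :=
    ((Lp.memLp g).integrable (by norm_num)).sub ((Lp.memLp g').integrable (by norm_num))
  have hae := isOpen_Ioo.ae_eq_zero_of_integral_contDiff_smul_eq_zero (μ := (volume : Measure ℝ))
    (U := Ioo (0 : ℝ) 1) (f := fun x => g x - g' x)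
    (IntegrableOn.locallyIntegrableOn hint) (by
      intro φ h1 h2 h3
      have hs : ∀ x, x ∉ Ioo (0 : ℝ) 1 → φ x • (g x - g' x) = 0 := by
        intro x hx
        rw [image_eq_zero_of_notMem_tsupport (fun hx' => hx (h3 hx')), zero_smul]
      rw [← setIntegral_eq_integral_of_forall_compl_eq_zero hs]
      have e : ∀ x, φ x • (g x - g' x) = g x * φ x - g' x * φ x := fun x => by
        rw [smul_eq_mul]; ring
      simp_rw [e]
      rw [integral_sub (integrable_mul g h1.continuous h2) (integrable_mul g' h1.continuous h2)]
      have := h φ h1 h2 h3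
      have := h' φ h1 h2 h3
      linarith)
  refine Lp.ext ?_
  rw [Filter.EventuallyEq, ae_restrict_iff' measurableSet_Ioo]
  filter_upwards [hae] with x hx hx'
  exact sub_eq_zero.mp (hx hx')

/-- The weak derivative of `f`, with the value `0` if `f` has none in `L²(0,1)`. -/
def weakDeriv (f : L2) : L2 :=
  open Classical in if h : ∃ g, IsWeakDeriv f g then h.choose else 0

theorem IsWeakDeriv.eq {f g : L2} (h : IsWeakDeriv f g) : weakDeriv f = g := by
  have hex : ∃ g, IsWeakDeriv f g := ⟨g, h⟩
  rw [weakDeriv, dif_pos hex]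
  exact hex.choose_spec.unique h

/-- `f ∈ H²(0,1)`: the function `f` and its first two weak derivatives are in `L²(0,1)`. -/
def MemH2 (f : L2) : Prop :=
  ∃ f₁ f₂ : L2, IsWeakDeriv f f₁ ∧ IsWeakDeriv f₁ f₂

theorem MemH2.isWeakDeriv {f : L2} (h : MemH2 f) : IsWeakDeriv f (weakDeriv f) := by
  obtain ⟨f₁, f₂, h1, -⟩ := h
  rwa [h1.eq]

theorem MemH2.isWeakDeriv₂ {f : L2} (h : MemH2 f) :
    IsWeakDeriv (weakDeriv f) (weakDeriv (weakDeriv f)) := by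
  obtain ⟨f₁, f₂, h1, h2⟩ := h
  rw [h1.eq]
  rwa [h2.eq]

theorem MemH2.zero : MemH2 0 := ⟨0, 0, isWeakDeriv_zero, isWeakDeriv_zero⟩

theorem MemH2.add {f g : L2} (hf : MemH2 f) (hg : MemH2 g) : MemH2 (f + g) :=
  ⟨_, _, hf.isWeakDeriv.add hg.isWeakDeriv, hf.isWeakDeriv₂.add hg.isWeakDeriv₂⟩

theorem MemH2.smul (c : ℝ) {f : L2} (hf : MemH2 f) : MemH2 (c • f) :=
  ⟨_, _, hf.isWeakDeriv.smul c, hf.isWeakDeriv₂.smul c⟩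

theorem weakDeriv_zero : weakDeriv 0 = 0 := isWeakDeriv_zero.eq

theorem MemH2.weakDeriv_add {f g : L2} (hf : MemH2 f) (hg : MemH2 g) :
    weakDeriv (f + g) = weakDeriv f + weakDeriv g := (hf.isWeakDeriv.add hg.isWeakDeriv).eq

theorem MemH2.weakDeriv_smul (c : ℝ) {f : L2} (hf : MemH2 f) :
    weakDeriv (c • f) = c • weakDeriv f := (hf.isWeakDeriv.smul c).eq

theorem MemH2.weakDeriv₂_add {f g : L2} (hf : MemH2 f) (hg : MemH2 g) :
    weakDeriv (weakDeriv (f + g)) = weakDeriv (weakDeriv f) + weakDeriv (weakDeriv g) := by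
  rw [hf.weakDeriv_add hg, (hf.isWeakDeriv₂.add hg.isWeakDeriv₂).eq]

theorem MemH2.weakDeriv₂_smul (c : ℝ) {f : L2} (hf : MemH2 f) :
    weakDeriv (weakDeriv (c • f)) = c • weakDeriv (weakDeriv f) := by
  rw [hf.weakDeriv_smul c, (hf.isWeakDeriv₂.smul c).eq]

/-- The representative of `f` that is continuous on `[0,1]` exists and takes the value `v` at the
point `x` (used for `x = 0` and `x = 1`). -/
def HasTrace (f : L2) (x v : ℝ) : Prop :=
  ∃ F : ℝ → ℝ, ContinuousOn F (Icc 0 1) ∧ f =ᵐ[mu01] F ∧ F x = v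

theorem HasTrace.zero (x : ℝ) : HasTrace 0 x 0 :=
  ⟨fun _ => 0, continuousOn_const, Lp.coeFn_zero ℝ 2 mu01, rfl⟩

theorem HasTrace.add {f g : L2} {x v w : ℝ} (hf : HasTrace f x v) (hg : HasTrace g x w) :
    HasTrace (f + g) x (v + w) := by
  obtain ⟨F, h1, h2, rfl⟩ := hf
  obtain ⟨G, h1', h2', rfl⟩ := hg
  exact ⟨F + G, h1.add h1', (Lp.coeFn_add f g).trans (h2.add h2'), rfl⟩

theorem HasTrace.smul (c : ℝ) {f : L2} {x v : ℝ} (hf : HasTrace f x v) :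
    HasTrace (c • f) x (c * v) := by
  obtain ⟨F, h1, h2, rfl⟩ := hf
  exact ⟨c • F, h1.const_smul c, (Lp.coeFn_smul c f).trans (h2.const_smul c), rfl⟩

/-! ### The coupled operator -/

/-- The domain of the operator: all `(f,g) ∈ H²(0,1) × H²(0,1)` with
`f(1) = g'(0) = g'(1) = 0` and `f'(0) = s g(0)`. -/
def opDomain (s : ℝ) : Submodule ℝ H0 where
  carrier := {u | MemH2 u.fst ∧ MemH2 u.snd ∧
    HasTrace u.fst 1 0 ∧ HasTrace (weakDeriv u.snd) 0 0 ∧ HasTrace (weakDeriv u.snd) 1 0 ∧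
    ∃ c : ℝ, HasTrace u.snd 0 c ∧ HasTrace (weakDeriv u.fst) 0 (s * c)}
  zero_mem' := by
    refine ⟨MemH2.zero, MemH2.zero, HasTrace.zero 1, ?_, ?_, 0, HasTrace.zero 0, ?_⟩ <;>
      simp [weakDeriv_zero, HasTrace.zero]
  add_mem' := by
    rintro u v ⟨h1, h2, h3, h4, h5, c, h6, h7⟩ ⟨k1, k2, k3, k4, k5, d, k6, k7⟩
    refine ⟨h1.add k1, h2.add k2, by simpa using h3.add k3, ?_, ?_, c + d, h6.add k6, ?_⟩
    · rw [WithLp.add_snd, h2.weakDeriv_add k2]; simpa using h4.add k4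
    · rw [WithLp.add_snd, h2.weakDeriv_add k2]; simpa using h5.add k5
    · rw [WithLp.add_fst, h1.weakDeriv_add k1, mul_add]; exact h7.add k7
  smul_mem' := by
    rintro r u ⟨h1, h2, h3, h4, h5, c, h6, h7⟩
    refine ⟨h1.smul r, h2.smul r, by simpa using h3.smul r, ?_, ?_, r * c, h6.smul r, ?_⟩
    · rw [WithLp.smul_snd, h2.weakDeriv_smul r]; simpa using h4.smul r
    · rw [WithLp.smul_snd, h2.weakDeriv_smul r]; simpa using h5.smul r
    · rw [WithLp.smul_fst, h1.weakDeriv_smul r, mul_left_comm]; exact h7.smul r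

/-- The unbounded operator `(f,g) ↦ (f'' + a f, g'' + b g)` on `L²(0,1) × L²(0,1)`. -/
def coupledOp (a b s : ℝ) : H0 →ₗ.[ℝ] H0 where
  domain := opDomain s
  toFun :=
    { toFun := fun u => WithLp.toLp 2
        (weakDeriv (weakDeriv u.1.fst) + a • u.1.fst, weakDeriv (weakDeriv u.1.snd) + b • u.1.snd)
      map_add' := by
        rintro ⟨u, hu⟩ ⟨v, hv⟩
        rw [← WithLp.toLp_add]
        congr 1
        refine Prod.ext ?_ ?_
        · simp only [Submodule.coe_add, WithLp.add_fst, Prod.fst_add, MemH2.weakDeriv₂_add hu.1 hv.1,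
            smul_add]
          abel
        · simp only [Submodule.coe_add, WithLp.add_snd, Prod.snd_add,
            MemH2.weakDeriv₂_add hu.2.1 hv.2.1, smul_add]
          abel
      map_smul' := by
        rintro c ⟨u, hu⟩
        rw [RingHom.id_apply, ← WithLp.toLp_smul]
        congr 1
        refine Prod.ext ?_ ?_
        · simp only [Submodule.coe_smul, WithLp.smul_fst, Prod.smul_fst,
            MemH2.weakDeriv₂_smul c hu.1, smul_add, smul_comm a c]
        · simp only [Submodule.coe_smul, WithLp.smul_snd, Prod.smul_snd,
            MemH2.weakDeriv₂_smul c hu.2.1, smul_add, smul_comm b c] }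

/-! ### The family of generalized eigenvectors -/

/-- The set `Δ(a,b)` of pairs `(n,m)` of natural numbers with
`4 (b - a) = (4 m² - (2 n + 1)²) π²`. -/
def Delta (a b : ℝ) : Set (ℕ × ℕ) :=
  {p | 4 * (b - a) = (4 * (p.2 : ℝ) ^ 2 - (2 * (p.1 : ℝ) + 1) ^ 2) * Real.pi ^ 2}

/-- The set `Δ₂(a,b)` of all `m` such that `(n,m) ∈ Δ(a,b)` for some `n`. -/
def Delta₂ (a b : ℝ) : Set ℕ := {m | ∃ n : ℕ, (n, m) ∈ Delta a b}

/-- The integer `k` with `(k,m) ∈ Δ(a,b)` is unique. -/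
theorem Delta_unique {a b : ℝ} {k k' m : ℕ} (h : (k, m) ∈ Delta a b) (h' : (k', m) ∈ Delta a b) :
    k = k' := by
  have e := h.symm.trans h'
  have e2 := mul_right_cancel₀ (pow_ne_zero 2 Real.pi_ne_zero) e
  have e3 : (2 * (k : ℝ) + 1) ^ 2 = (2 * (k' : ℝ) + 1) ^ 2 := by simpa using e2
  have e4 := (pow_left_inj₀ (by positivity) (by positivity) two_ne_zero).mp e3
  have e5 : (k : ℝ) = k' := by linarith
  exact_mod_cast e5

/-- `λ_{1,n} = a - (n + 1/2)² π²`. -/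
def eig₁ (a : ℝ) (n : ℕ) : ℝ := a - ((n : ℝ) + 1 / 2) ^ 2 * Real.pi ^ 2

/-- `λ_{2,m} = b - m² π²`. -/
def eig₂ (b : ℝ) (m : ℕ) : ℝ := b - (m : ℝ) ^ 2 * Real.pi ^ 2

/-- The first component of `φ_{1,n}`. -/
def phi₁₁ (n : ℕ) (x : ℝ) : ℝ := √2 * Real.cos (((n : ℝ) + 1 / 2) * Real.pi * x)

/-- The second component of `φ_{2,m}`. -/
def phi₂₂ (m : ℕ) (x : ℝ) : ℝ := if m = 0 then 1 else √2 * Real.cos ((m : ℝ) * Real.pi * x)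

/-- `μ_m = φ_{2,m}²(0)`. -/
def muCoef (m : ℕ) : ℝ := phi₂₂ m 0

/-- A complex square root `r_m` of `λ_{2,m} - a`. -/
def rootR (a b : ℝ) (m : ℕ) : ℂ := ((eig₂ b m - a : ℝ) : ℂ) ^ (1 / 2 : ℂ)

open Classical in
/-- The first component of `φ_{2,m}`. In the last case the complex number is real and does not
depend on the choice of the square root, see `ofReal_phi₂₁`. -/
def phi₂₁ (a b s : ℝ) (m : ℕ) (x : ℝ) : ℝ :=
  if h : m ∈ Delta₂ a b then
    s * muCoef m / (((h.choose : ℕ) + 1 / 2 : ℝ) * Real.pi) *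
      ((1 - x) * Real.sin (((h.choose : ℕ) + 1 / 2 : ℝ) * Real.pi * x))
  else if b - a = (m : ℝ) ^ 2 * Real.pi ^ 2 then
    s * muCoef m * (-1 + x)
  else
    (-((s * muCoef m : ℝ) : ℂ) / (rootR a b m * Complex.cosh (rootR a b m)) *
      Complex.sinh (rootR a b m * (1 - (x : ℂ)))).re

theorem rootR_sq (a b : ℝ) (m : ℕ) : rootR a b m ^ 2 = ((eig₂ b m - a : ℝ) : ℂ) := by
  rw [rootR, ← Complex.cpow_nat_mul]
  norm_num

theorem ofReal_phi₂₁ {a b s : ℝ} {m : ℕ} (h : m ∉ Delta₂ a b)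
    (h' : b - a ≠ (m : ℝ) ^ 2 * Real.pi ^ 2) {r : ℂ} (hr : r ^ 2 = ((eig₂ b m - a : ℝ) : ℂ))
    (x : ℝ) :
    (phi₂₁ a b s m x : ℂ) =
      -((s * muCoef m : ℝ) : ℂ) / (r * Complex.cosh r) * Complex.sinh (r * (1 - (x : ℂ))) := by
  have indep : ∀ r₁ r₂ : ℂ, r₁ ^ 2 = r₂ ^ 2 → ∀ c : ℂ,
      c / (r₁ * Complex.cosh r₁) * Complex.sinh (r₁ * (1 - (x : ℂ))) =
      c / (r₂ * Complex.cosh r₂) * Complex.sinh (r₂ * (1 - (x : ℂ))) := by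
    intro r₁ r₂ hrr c
    rcases sq_eq_sq_iff_eq_or_eq_neg.mp hrr with rfl | rfl
    · rfl
    · rw [Complex.cosh_neg, neg_mul, neg_mul, Complex.sinh_neg, div_neg, neg_mul_neg]
  rw [phi₂₁, dif_neg h, if_neg h', indep _ r ((rootR_sq a b m).trans hr.symm)]
  have hconj : (starRingEnd ℂ r) ^ 2 = r ^ 2 := by
    rw [← map_pow, hr, Complex.conj_ofReal]
  apply Complex.conj_eq_iff_re.mp
  have key := indep _ r hconj (-((s * muCoef m : ℝ) : ℂ))
  rw [← key]
  simp only [map_mul, map_div₀, map_neg, Complex.conj_ofReal, ← Complex.cosh_conj,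
    ← Complex.sinh_conj, map_sub, map_one, Complex.conj_conj]
  exact key.symm

theorem continuous_phi₁₁ (n : ℕ) : Continuous (phi₁₁ n) := by
  unfold phi₁₁; fun_prop

theorem continuous_phi₂₂ (m : ℕ) : Continuous (phi₂₂ m) := by
  unfold phi₂₂; split_ifs <;> fun_prop

theorem continuous_phi₂₁ (a b s : ℝ) (m : ℕ) : Continuous (phi₂₁ a b s m) := by
  unfold phi₂₁
  split_ifs
  · fun_prop
  · fun_prop
  · exact Complex.continuous_re.comp (continuous_const.mul
      (Complex.continuous_sinh.comp (by fun_prop)))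

theorem memLp_of_continuous {f : ℝ → ℝ} (hf : Continuous f) : MemLp f 2 mu01 := by
  obtain ⟨C, hC⟩ := isCompact_Icc.exists_bound_of_continuousOn (s := Icc (0 : ℝ) 1)
    hf.continuousOn
  refine MemLp.of_bound hf.aestronglyMeasurable C ?_
  filter_upwards [ae_restrict_mem measurableSet_Ioo] with x hx
  exact hC x (Ioo_subset_Icc_self hx)

/-- The element of `L²(0,1)` given by a continuous function. -/
def toL2 (f : ℝ → ℝ) (hf : Continuous f) : L2 := (memLp_of_continuous hf).toLp f

/-- `φ_{1,n} = (φ_{1,n}¹, 0)`. -/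
def Phi₁ (n : ℕ) : H0 := WithLp.toLp 2 (toL2 (phi₁₁ n) (continuous_phi₁₁ n), 0)

/-- `φ_{2,m} = (φ_{2,m}¹, φ_{2,m}²)`. -/
def Phi₂ (a b s : ℝ) (m : ℕ) : H0 :=
  WithLp.toLp 2 (toL2 (phi₂₁ a b s m) (continuous_phi₂₁ a b s m),
    toL2 (phi₂₂ m) (continuous_phi₂₂ m))

/-- The family `Φ` of all `φ_{1,n}` and all `φ_{2,m}`. -/
def Phi (a b s : ℝ) : ℕ ⊕ ℕ → H0 := Sum.elim Phi₁ (Phi₂ a b s)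

/-- The eigenvalues `λ_{1,n}` and `λ_{2,m}`, indexed as `Phi`. -/
def eig (a b : ℝ) : ℕ ⊕ ℕ → ℝ := Sum.elim (eig₁ a) (eig₂ b)

/-! ### General notions -/

/-- A Riesz basis: the image of an orthonormal (Hilbert) basis under a bounded linear operator with
bounded inverse. -/
def IsRieszBasis {ι E : Type*} [NormedAddCommGroup E] [InnerProductSpace ℝ E] (v : ι → E) : Prop :=
  ∃ (e : HilbertBasis ι ℝ E) (T : E ≃L[ℝ] E), ∀ i, v i = T (e i)

/-- `u` is in the domain of `(A - lam)^k` and `(A - lam)^k u = 0`. -/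
def PowKills {E : Type*} [AddCommGroup E] [Module ℝ E] (A : E →ₗ.[ℝ] E) (lam : ℝ) : ℕ → E → Prop
  | 0, u => u = 0
  | k + 1, u => ∃ h : u ∈ A.domain, PowKills A lam k (A ⟨u, h⟩ - lam • u)

/-- `u` is a generalized eigenvector of `A` associated with `lam`. -/
def IsGeneralizedEigenvector {E : Type*} [AddCommGroup E] [Module ℝ E] (A : E →ₗ.[ℝ] E)
    (lam : ℝ) (u : E) : Prop :=
  u ≠ 0 ∧ ∃ k : ℕ, PowKills A lam k u

/-- A `C₀`-semigroup of bounded linear operators. -/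
structure C0Semigroup (E : Type*) [NormedAddCommGroup E] [NormedSpace ℝ E] where
  /-- The operator at time `t`. -/
  op : ℝ≥0 → E →L[ℝ] E
  op_zero : op 0 = ContinuousLinearMap.id ℝ E
  op_add : ∀ t t' : ℝ≥0, op (t + t') = (op t).comp (op t')
  strongly_continuous : ∀ u : E, Tendsto (fun t : ℝ≥0 => op t u) (𝓝[>] 0) (𝓝 u)

/-- `A` is the infinitesimal generator of the semigroup `S`: the limit of `(S(t)u - u)/t` as
`t → 0+` exists exactly for `u` in the domain of `A`, and then it is `A u`. -/
def C0Semigroup.IsGenerator {E : Type*} [NormedAddCommGroup E] [NormedSpace ℝ E]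
    (S : C0Semigroup E) (A : E →ₗ.[ℝ] E) : Prop :=
  ∀ u w : E, Tendsto (fun t : ℝ≥0 => (t : ℝ)⁻¹ • (S.op t u - u)) (𝓝[>] 0) (𝓝 w) ↔
    ∃ h : u ∈ A.domain, A ⟨u, h⟩ = w

/-- `A` generates a `C₀`-semigroup. -/
def GeneratesC0Semigroup {E : Type*} [NormedAddCommGroup E] [NormedSpace ℝ E]
    (A : E →ₗ.[ℝ] E) : Prop :=
  ∃ S : C0Semigroup E, S.IsGenerator A

end HeatCascade

end

noncomputable section

namespace HeatCascade

/-! ### Diagonal operators in a Hilbert basis -/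

section Diagonal

variable {ι E F : Type*} [NormedAddCommGroup E] [InnerProductSpace ℝ E]
  [NormedAddCommGroup F] [NormedSpace ℝ F] (e : HilbertBasis ι ℝ E)

/-! The system is a cascade: the second component evolves by itself under the Neumann Laplacian, and
it enters the first only through f'(0) = s g(0). Without coupling, the operator is diagonal in the
orthonormal basis of all (cos((n+1/2)πx), 0) and (0, cos(mπx)), suitably normalized
(`exists_hilbertBasis_cosFamily`). The coupling only adds a first component to the second kind of
vector. Hence Φ is the image of this basis under (f, g) ↦ (f + Kg, g), where K sends the m-th
Neumann cosine to φ¹_{2,m}. Since ‖φ¹_{2,m}‖ = O(1/m) (`abs_phi₂₁_le`), K is bounded, indeed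
Hilbert–Schmidt. The block operator (f, g) ↦ (Kg, 0) squares to zero, so (f, g) ↦ (f − Kg, g) is the
inverse and the Riesz basis property follows at once.

Solving f'' + af = λ_{2,m} f with f(1) = 0 and f'(0) = sμ_m gives (𝒜 − λ_{2,m})φ_{2,m} = 0, except
at resonance λ_{2,m} = λ_{1,k}, where the result is a multiple of φ_{1,k} (`exists_deriv_phi₂₁`). In
the coordinates of the Riesz basis, 𝒜 is therefore G + N with G diagonal, N² = 0 and GN = NG. Every
vector of Φ is killed by (𝒜 − λ)², and the semigroup is exp(tG)(1 + tN).

The domain of the generator must equal the prescribed one. The generator is contained in 𝒜 because 𝒜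
is closed (`isClosed_coupledOp`). The reverse inclusion holds because, for l₀ > max(a, b), the
generator minus l₀ is onto while 𝒜 − l₀ is injective (`eq_zero_of_mem_graph`). Both facts about 𝒜
rest on writing H² functions as iterated primitives (`isWeakDeriv_iff`, `mem_graph_coupledOp_iff`).
-/

theorem ext_inner_basis {x y : E} (h : ∀ i, inner ℝ (e i) x = inner ℝ (e i) y) : x = y := by
  refine e.repr.injective (lp.ext (funext fun i => ?_))
  rw [e.repr_apply_apply, e.repr_apply_apply, h]

theorem summable_inner_sq (x : E) : Summable fun i => (inner ℝ (e i) x) ^ 2 := by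
  simpa [pow_two, real_inner_comm] using e.summable_inner_mul_inner x x

theorem norm_sq_eq_tsum (x : E) : ‖x‖ ^ 2 = ∑' i, (inner ℝ (e i) x) ^ 2 := by
  rw [← real_inner_self_eq_norm_sq, ← e.tsum_inner_mul_inner x x]
  simp [pow_two, real_inner_comm]

theorem exists_inner_eq {d : ι → ℝ} (hd : Summable fun i => d i ^ 2) :
    ∃ y : E, ∀ i, inner ℝ (e i) y = d i := by
  have hm : Memℓp d 2 := memℓp_gen (by simpa using hd)
  refine ⟨e.repr.symm ⟨d, hm⟩, fun i => ?_⟩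
  rw [← e.repr_apply_apply, LinearIsometryEquiv.apply_symm_apply]

theorem inner_basis [DecidableEq ι] (i j : ι) : inner ℝ (e i) (e j) = if i = j then 1 else 0 :=
  orthonormal_iff_ite.mp e.orthonormal i j

theorem summable_mul_inner_sq {m : ι → ℝ} {C : ℝ} (hm : ∀ i, |m i| ≤ C) (x : E) :
    Summable fun i => (m i * inner ℝ (e i) x) ^ 2 := by
  refine Summable.of_nonneg_of_le (fun i => sq_nonneg _) (fun i => ?_)
    ((summable_inner_sq e x).mul_left (C ^ 2))
  rw [mul_pow]
  exact mul_le_mul_of_nonneg_right (sq_le_sq' (abs_le.mp (hm i)).1 (abs_le.mp (hm i)).2)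
    (sq_nonneg _)

/-- The bounded operator that multiplies the `i`-th coordinate by `m i`. -/
def diagOp (m : ι → ℝ) (C : ℝ) (hm : ∀ i, |m i| ≤ C) : E →L[ℝ] E :=
  have spec := fun x => (exists_inner_eq e (summable_mul_inner_sq e hm x)).choose_spec
  -- The norm bound is |C|, since C may be negative when ι is empty.
  LinearMap.mkContinuous
    { toFun := fun x => (exists_inner_eq e (summable_mul_inner_sq e hm x)).choose
      map_add' := fun x y => ext_inner_basis e fun i => by
        rw [inner_add_right, spec, spec, spec, inner_add_right, mul_add]
      map_smul' := fun c x => ext_inner_basis e fun i => by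
        rw [RingHom.id_apply, inner_smul_right, spec, spec, inner_smul_right]; ring } |C| (by
      intro x
      refine abs_le_of_sq_le_sq' ?_ (by positivity) |>.2
      change ‖(exists_inner_eq e (summable_mul_inner_sq e hm x)).choose‖ ^ 2 ≤ _
      rw [norm_sq_eq_tsum e, mul_pow, norm_sq_eq_tsum e x, ← tsum_mul_left]
      refine Summable.tsum_le_tsum (fun i => ?_) (summable_inner_sq e _)
        ((summable_inner_sq e x).mul_left _)
      rw [spec, mul_pow]
      exact mul_le_mul_of_nonneg_right (sq_le_sq.mpr (by
        rw [abs_abs]; exact (hm i).trans (le_abs_self C))) (sq_nonneg _))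

theorem inner_diagOp {m : ι → ℝ} {C : ℝ} (hm : ∀ i, |m i| ≤ C) (x : E) (i : ι) :
    inner ℝ (e i) (diagOp e m C hm x) = m i * inner ℝ (e i) x :=
  (exists_inner_eq e (summable_mul_inner_sq e hm x)).choose_spec i

theorem diagOp_basis {m : ι → ℝ} {C : ℝ} (hm : ∀ i, |m i| ≤ C) (j : ι) :
    diagOp e m C hm (e j) = m j • e j := by
  classical
  refine ext_inner_basis e fun i => ?_
  rw [inner_diagOp, inner_smul_right, inner_basis]
  split_ifs with h
  · rw [h]
  · simp

theorem clm_ext_basis {S T : E →L[ℝ] F} (h : ∀ i, S (e i) = T (e i)) : S = T := by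
  refine ContinuousLinearMap.ext_on (s := range e) ?_ ?_
  · rw [dense_iff_closure_eq, ← Submodule.topologicalClosure_coe, e.dense_span]; rfl
  · rintro _ ⟨i, rfl⟩; exact h i

/-- Diagonal operators with uniformly bounded multipliers that tend to `1` pointwise tend to the
identity strongly. -/
theorem tendsto_of_multiplier {α : Type*} {l : Filter α} {m : α → ι → ℝ} {C : ℝ}
    (hb : ∀ᶠ t in l, ∀ i, |m t i| ≤ C) (hm : ∀ i, Tendsto (fun t => m t i) l (𝓝 1)) {z : E}
    {y : α → E} (hy : ∀ᶠ t in l, ∀ i, inner ℝ (e i) (y t) = m t i * inner ℝ (e i) z) :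
    Tendsto y l (𝓝 z) := by
  rw [tendsto_iff_norm_sub_tendsto_zero]
  -- By Parseval this sum is the squared distance; it is dominated termwise by (C+1)² times the
  -- squared coordinates of z.
  have key : Tendsto (fun t => ∑' i, ((m t i - 1) * inner ℝ (e i) z) ^ 2) l
      (𝓝 (∑' _ : ι, (0 : ℝ))) := by
    refine tendsto_tsum_of_dominated_convergence
      ((summable_inner_sq e z).mul_left ((C + 1) ^ 2)) (fun i => ?_) ?_
    · have := (((hm i).sub_const 1).mul_const (inner ℝ (e i) z)).pow 2
      simpa using this
    · filter_upwards [hb] with t ht i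
      rw [Real.norm_eq_abs, abs_of_nonneg (sq_nonneg _), mul_pow]
      refine mul_le_mul_of_nonneg_right ?_ (sq_nonneg _)
      have := abs_le.mp (ht i)
      exact sq_le_sq' (by linarith) (by linarith)
  rw [tsum_zero] at key
  have h2 := (Real.continuous_sqrt.tendsto 0).comp key
  rw [Real.sqrt_zero] at h2
  refine h2.congr' ?_
  filter_upwards [hy] with t ht
  rw [Function.comp_apply, ← Real.sqrt_sq (norm_nonneg (y t - z)), norm_sq_eq_tsum e]
  congr 2
  funext i
  rw [inner_sub_right, ht]
  ring

/-- A square summable family is the image of a Hilbert basis under a bounded operator. -/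
theorem exists_clm_of_summable [CompleteSpace F] {w : ι → F} (hw : Summable fun i => ‖w i‖ ^ 2) :
    ∃ K : E →L[ℝ] F, ∀ i, K (e i) = w i := by
  classical
  have hs : ∀ x : E, Summable fun i => ‖inner ℝ (e i) x • w i‖ := fun x => by
    refine Summable.of_nonneg_of_le (fun i => norm_nonneg _) (fun i => ?_)
      ((summable_inner_sq e x).add hw)
    rw [norm_smul, Real.norm_eq_abs]
    nlinarith [sq_nonneg (|inner ℝ (e i) x| - ‖w i‖), sq_abs (inner ℝ (e i) x),
      sq_nonneg (inner ℝ (e i) x), sq_nonneg ‖w i‖]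
  -- The operator norm is bounded by the Hilbert–Schmidt norm, through Cauchy–Schwarz on finite
  -- sums.
  refine ⟨LinearMap.mkContinuous
    { toFun := fun x => ∑' i, inner ℝ (e i) x • w i
      map_add' := fun x y => by
        rw [← (hs x).of_norm.tsum_add (hs y).of_norm]
        simp_rw [inner_add_right, add_smul]
      map_smul' := fun c x => by
        rw [RingHom.id_apply, ← (hs x).of_norm.tsum_const_smul]
        simp_rw [inner_smul_right, mul_smul] } (√(∑' i, ‖w i‖ ^ 2)) ?_, fun j => ?_⟩
  · intro x
    refine (norm_tsum_le_tsum_norm (hs x)).trans ?_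
    refine Real.tsum_le_of_sum_le (fun i => norm_nonneg _) fun s => ?_
    simp_rw [norm_smul]
    refine (Real.sum_mul_le_sqrt_mul_sqrt s _ _).trans ?_
    rw [mul_comm]
    refine mul_le_mul (Real.sqrt_le_sqrt (hw.sum_le_tsum s fun i _ => sq_nonneg _)) ?_
      (Real.sqrt_nonneg _) (Real.sqrt_nonneg _)
    rw [← Real.sqrt_sq (norm_nonneg x), norm_sq_eq_tsum e]
    simp_rw [Real.norm_eq_abs, sq_abs]
    exact Real.sqrt_le_sqrt ((summable_inner_sq e x).sum_le_tsum s fun i _ => sq_nonneg _)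
  · change ∑' i, inner ℝ (e i) (e j) • w i = w j
    rw [tsum_eq_single j]
    · rw [inner_basis, if_pos rfl, one_smul]
    · intro i hi
      simp [inner_basis, hi]

end Diagonal

/-! ### Generators that are diagonal up to a commuting nilpotent operator -/

section Generation

variable {ι E : Type*} [NormedAddCommGroup E] [InnerProductSpace ℝ E] (e : HilbertBasis ι ℝ E)

/-- N maps e i to a multiple of some e j with the same `lam`, and the multiplier depends on `lam`
only. So the two operators commute on the basis, hence everywhere by continuity. -/
theorem diagOp_comm {lam m : ι → ℝ} {C : ℝ} (hm : ∀ i, |m i| ≤ C)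
    (hml : ∀ i j, lam i = lam j → m i = m j) {N : E →L[ℝ] E}
    (hN : ∀ i, N (e i) = 0 ∨ ∃ (j : ι) (c : ℝ), lam j = lam i ∧ N (e i) = c • e j) (x : E) :
    N (diagOp e m C hm x) = diagOp e m C hm (N x) := by
  have : N.comp (diagOp e m C hm) = (diagOp e m C hm).comp N := by
    refine clm_ext_basis e fun i => ?_
    rw [ContinuousLinearMap.comp_apply, ContinuousLinearMap.comp_apply, diagOp_basis, map_smul]
    rcases hN i with h | ⟨j, c, hj, h⟩
    · rw [h, smul_zero, map_zero]
    · rw [h, map_smul, diagOp_basis, hml j i hj, smul_comm]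
  exact congrArg (fun S : E →L[ℝ] E => S x) this

theorem abs_exp_mul_le {l om : ℝ} (h : l ≤ om) (t : ℝ≥0) :
    |Real.exp (l * t)| ≤ Real.exp (om * t) := by
  rw [Real.abs_exp]
  exact Real.exp_le_exp.mpr (mul_le_mul_of_nonneg_right h t.2)

/-- The diagonal semigroup with multipliers `exp (lam i * t)`. -/
def diagExp {lam : ι → ℝ} {om : ℝ} (h : ∀ i, lam i ≤ om) (t : ℝ≥0) : E →L[ℝ] E :=
  diagOp e (fun i => Real.exp (lam i * t)) (Real.exp (om * t)) fun i => abs_exp_mul_le (h i) t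

theorem inner_diagExp {lam : ι → ℝ} {om : ℝ} (h : ∀ i, lam i ≤ om) (t : ℝ≥0) (x : E) (i : ι) :
    inner ℝ (e i) (diagExp e h t x) = Real.exp (lam i * t) * inner ℝ (e i) x :=
  inner_diagOp e _ x i

theorem tendsto_coe_nhdsGT_zero : Tendsto (fun t : ℝ≥0 => (t : ℝ)) (𝓝[>] 0) (𝓝[>] 0) := by
  refine tendsto_nhdsWithin_iff.mpr ⟨?_, ?_⟩
  · exact (NNReal.continuous_coe.tendsto 0).mono_left nhdsWithin_le_nhds
  · filter_upwards [self_mem_nhdsWithin] with t ht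
    exact ht

theorem eventually_le_one_nhdsGT_zero : ∀ᶠ t : ℝ≥0 in 𝓝[>] 0, t ≤ 1 :=
  nhdsWithin_le_nhds (Iic_mem_nhds zero_lt_one)

theorem tendsto_diagExp {lam : ι → ℝ} {om : ℝ} (h : ∀ i, lam i ≤ om) (x : E) :
    Tendsto (fun t : ℝ≥0 => diagExp e h t x) (𝓝[>] 0) (𝓝 x) := by
  refine tendsto_of_multiplier e (m := fun (t : ℝ≥0) i => Real.exp (lam i * t)) (C := Real.exp |om|)
    ?_ (fun i => ?_) (Eventually.of_forall fun t i => inner_diagExp e h t x i)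
  · filter_upwards [eventually_le_one_nhdsGT_zero] with t ht i
    refine (abs_exp_mul_le (h i) t).trans (Real.exp_le_exp.mpr ?_)
    have ht' : (t : ℝ) ≤ 1 := ht
    nlinarith [le_abs_self om, abs_nonneg om, t.2]
  · have : Continuous fun t : ℝ≥0 => Real.exp (lam i * t) := by fun_prop
    simpa using (this.tendsto 0).mono_left nhdsWithin_le_nhds

/-- The difference quotient `(exp (l t) - 1) / (l t)`, with the value `1` at `l = 0`. -/
def expQuot (l t : ℝ) : ℝ := if l = 0 then 1 else t⁻¹ * (Real.exp (l * t) - 1) / l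

theorem tendsto_inv_mul_exp_sub_one (l : ℝ) :
    Tendsto (fun t : ℝ≥0 => (t : ℝ)⁻¹ * (Real.exp (l * t) - 1)) (𝓝[>] 0) (𝓝 l) := by
  have hd : HasDerivAt (fun t : ℝ => Real.exp (l * t)) l 0 := by
    simpa using ((hasDerivAt_id (0 : ℝ)).const_mul l).exp
  have := (hasDerivAt_iff_tendsto_slope.mp hd).mono_left
    (nhdsWithin_mono (0 : ℝ) (fun x (hx : 0 < x) => hx.ne'))
  refine (this.comp tendsto_coe_nhdsGT_zero).congr fun t => ?_
  simp [slope]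

theorem tendsto_expQuot (l : ℝ) : Tendsto (fun t : ℝ≥0 => expQuot l t) (𝓝[>] 0) (𝓝 1) := by
  unfold expQuot
  split_ifs with hl
  · exact tendsto_const_nhds
  · have := (tendsto_inv_mul_exp_sub_one l).div_const l
    rwa [div_self hl] at this

/-- With x = l t, the quotient (eˣ − 1)/x lies in [0, 1] for x < 0 by eˣ ≥ 1 + x, and is at most eˣ
for x > 0 by e⁻ˣ ≥ 1 − x. The bound is independent of l, although the eigenvalues may be unbounded
below; this is the domination needed to identify the generator. -/
theorem abs_expQuot_le {l om t : ℝ} (hl : l ≤ om) (ht : 0 < t) (ht1 : t ≤ 1) :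
    |expQuot l t| ≤ Real.exp |om| := by
  have h1 : (1 : ℝ) ≤ Real.exp |om| := Real.one_le_exp (abs_nonneg om)
  unfold expQuot
  split_ifs with h0
  · simp
  rcases lt_or_gt_of_ne h0 with hneg | hpos
  · have e1 : t⁻¹ * (Real.exp (l * t) - 1) / l = (1 - Real.exp (l * t)) / (-l * t) := by
      field_simp
      ring
    have hlt : 0 < -l * t := mul_pos (neg_pos.mpr hneg) ht
    have h2 : Real.exp (l * t) ≤ 1 := Real.exp_le_one_iff.mpr (by linarith)
    rw [e1, abs_of_nonneg (div_nonneg (by linarith) hlt.le), div_le_iff₀ hlt]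
    nlinarith [Real.add_one_le_exp (l * t)]
  · have hlt : 0 < l * t := mul_pos hpos ht
    have e1 : t⁻¹ * (Real.exp (l * t) - 1) / l = (Real.exp (l * t) - 1) / (l * t) := by
      field_simp
    have h2 : 1 ≤ Real.exp (l * t) := Real.one_le_exp hlt.le
    rw [e1, abs_of_nonneg (div_nonneg (by linarith) hlt.le), div_le_iff₀ hlt]
    have h3 : Real.exp (l * t) - 1 ≤ l * t * Real.exp (l * t) := by
      have h4 := Real.add_one_le_exp (-(l * t))
      have h5 : Real.exp (-(l * t)) * Real.exp (l * t) = 1 := by rw [← Real.exp_add]; simp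
      nlinarith [Real.exp_pos (l * t)]
    have h6 : Real.exp (l * t) ≤ Real.exp |om| := by
      refine Real.exp_le_exp.mpr ?_
      have := le_abs_self om
      nlinarith
    nlinarith

/-- The generator of the diagonal semigroup. -/
theorem tendsto_diagExp_sub_iff {lam : ι → ℝ} {om : ℝ} (h : ∀ i, lam i ≤ om) (x z : E) :
    Tendsto (fun t : ℝ≥0 => (t : ℝ)⁻¹ • (diagExp e h t x - x)) (𝓝[>] 0) (𝓝 z) ↔
      ∀ i, lam i * inner ℝ (e i) x = inner ℝ (e i) z := by
  constructor
  · intro hz i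
    have h1 : Tendsto (fun t : ℝ≥0 => inner ℝ (e i) ((t : ℝ)⁻¹ • (diagExp e h t x - x)))
        (𝓝[>] 0) (𝓝 (inner ℝ (e i) z)) := tendsto_const_nhds.inner hz
    have h2 := (tendsto_inv_mul_exp_sub_one (lam i)).mul_const (inner ℝ (e i) x)
    refine tendsto_nhds_unique h2 (h1.congr fun t => ?_)
    rw [inner_smul_right, inner_sub_right, inner_diagExp]
    ring
  · intro hz
    refine tendsto_of_multiplier e (m := fun (t : ℝ≥0) i => expQuot (lam i) t) (C := Real.exp |om|)
      ?_ (fun i => tendsto_expQuot (lam i)) (Eventually.of_forall fun t i => ?_)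
    · filter_upwards [eventually_le_one_nhdsGT_zero, self_mem_nhdsWithin] with t ht ht0 i
      exact abs_expQuot_le (h i) ht0 ht
    · rw [inner_smul_right, inner_sub_right, inner_diagExp, ← hz i, expQuot]
      -- If `lam i = 0`, the i-th coordinate of z vanishes too, so the default value 1 of `expQuot`
      -- is harmless.
      split_ifs with h0
      · simp [h0]
      · field_simp

variable {lam : ι → ℝ} {om : ℝ} (h : ∀ i, lam i ≤ om) {N : E →L[ℝ] E}

theorem diagExp_comm
    (hN : ∀ i, N (e i) = 0 ∨ ∃ (j : ι) (c : ℝ), lam j = lam i ∧ N (e i) = c • e j)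
    (t : ℝ≥0) (x : E) : N (diagExp e h t x) = diagExp e h t (N x) :=
  diagOp_comm e (fun i => abs_exp_mul_le (h i) t) (fun i j hij => by rw [hij]) hN x

theorem diagExp_zero (x : E) : diagExp e h 0 x = x :=
  ext_inner_basis e fun i => by rw [inner_diagExp]; simp

theorem diagExp_add (t t' : ℝ≥0) (x : E) :
    diagExp e h (t + t') x = diagExp e h t (diagExp e h t' x) :=
  ext_inner_basis e fun i => by
    rw [inner_diagExp, inner_diagExp, inner_diagExp, NNReal.coe_add, mul_add, Real.exp_add,
      mul_assoc]

/-- The semigroup `T exp(tG) (1 + tN) T⁻¹`, with `G` diagonal and `N` nilpotent. -/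
def jordanSemigroup
    (hN : ∀ i, N (e i) = 0 ∨ ∃ (j : ι) (c : ℝ), lam j = lam i ∧ N (e i) = c • e j)
    (hNN : ∀ x, N (N x) = 0) (T : E ≃L[ℝ] E) : C0Semigroup E where
  -- This is T exp(t(G + N)) T⁻¹: N commutes with exp(tG), and the series of exp(tN) stops after its
  -- linear term.
  op t := (T : E →L[ℝ] E).comp (((diagExp e h t).comp
    (ContinuousLinearMap.id ℝ E + (t : ℝ) • N)).comp (T.symm : E →L[ℝ] E))
  op_zero := by
    ext x
    simp [diagExp_zero]
  op_add t t' := by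
    ext x
    simp only [ContinuousLinearMap.comp_apply, add_apply,
      ContinuousLinearMap.id_apply, smul_apply, ContinuousLinearEquiv.coe_coe,
      ContinuousLinearEquiv.symm_apply_apply, map_add, map_smul, diagExp_add,
      diagExp_comm e h hN, hNN, map_zero, smul_zero, add_zero, NNReal.coe_add, add_smul]
    abel
  strongly_continuous u := by
    have h1 := tendsto_diagExp e h (T.symm u)
    have h2 := (tendsto_coe_nhdsGT_zero.mono_right nhdsWithin_le_nhds).smul
      (tendsto_diagExp e h (N (T.symm u)))
    have h3 := (T.continuous.tendsto _).comp (h1.add h2)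
    rw [zero_smul, add_zero, T.apply_symm_apply] at h3
    refine h3.congr fun t => ?_
    simp

/-- After conjugation by T, the difference quotient is that of the diagonal semigroup plus exp(tG) N
T⁻¹u. The extra term always converges, to N T⁻¹u, so the nilpotent part does not change the domain.
-/
theorem tendsto_jordanSemigroup_iff
    (hN : ∀ i, N (e i) = 0 ∨ ∃ (j : ι) (c : ℝ), lam j = lam i ∧ N (e i) = c • e j)
    (hNN : ∀ x, N (N x) = 0) (T : E ≃L[ℝ] E) (u w : E) :
    Tendsto (fun t : ℝ≥0 => (t : ℝ)⁻¹ • ((jordanSemigroup e h hN hNN T).op t u - u))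
      (𝓝[>] 0) (𝓝 w) ↔
    ∀ i, lam i * inner ℝ (e i) (T.symm u) = inner ℝ (e i) (T.symm w - N (T.symm u)) := by
  rw [← tendsto_diagExp_sub_iff e h]
  have hD := tendsto_diagExp e h (N (T.symm u))
  have key : ∀ᶠ t : ℝ≥0 in 𝓝[>] 0,
      T.symm ((t : ℝ)⁻¹ • ((jordanSemigroup e h hN hNN T).op t u - u)) =
      (t : ℝ)⁻¹ • (diagExp e h t (T.symm u) - T.symm u) + diagExp e h t (N (T.symm u)) := by
    filter_upwards [self_mem_nhdsWithin] with t ht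
    have ht' : (t : ℝ) ≠ 0 := (show (0 : ℝ) < t from ht).ne'
    simp only [jordanSemigroup, ContinuousLinearMap.comp_apply, add_apply,
      ContinuousLinearMap.id_apply, smul_apply, ContinuousLinearEquiv.coe_coe,
      ContinuousLinearEquiv.symm_apply_apply, map_add, map_smul, map_sub, smul_sub, smul_add,
      inv_smul_smul₀ ht']
    abel
  constructor
  · intro hw
    have h1 := (((T.symm.continuous.tendsto w).comp hw).congr' key).sub hD
    simpa using h1
  · intro hw
    have h1 := ((hw.add hD).congr' (key.mono fun t ht => ht.symm))
    have h2 := (T.continuous.tendsto _).comp h1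
    simpa [Function.comp_def] using h2

/-- An operator with closed graph that is diagonal up to a nilpotent operator in a Riesz basis,
with eigenvalues bounded above, and such that some number to the right of the eigenvalues is not an
eigenvalue, generates a `C₀`-semigroup. -/
theorem generatesC0Semigroup_of_rieszBasis (h : ∀ i, lam i ≤ om)
    (hN : ∀ i, N (e i) = 0 ∨ ∃ (j : ι) (c : ℝ), lam j = lam i ∧ N (e i) = c • e j)
    (hNN : ∀ x, N (N x) = 0) (T : E ≃L[ℝ] E) {A : E →ₗ.[ℝ] E} (hA : A.IsClosed)
    (hT : ∀ i, (T (e i), T (lam i • e i + N (e i))) ∈ A.graph) {l₀ : ℝ} (hl₀ : om < l₀)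
    (hinj : ∀ u, (u, l₀ • u) ∈ A.graph → u = 0) : GeneratesC0Semigroup A := by
  refine ⟨jordanSemigroup e h hN hNN T, fun u w => ?_⟩
  rw [tendsto_jordanSemigroup_iff]
  have hgr : ∀ u w, (∃ h : u ∈ A.domain, A ⟨u, h⟩ = w) ↔ (u, w) ∈ A.graph := fun u w => by
    rw [LinearPMap.mem_graph_iff]
    exact ⟨fun ⟨h, h'⟩ => ⟨⟨u, h⟩, rfl, h'⟩, fun ⟨y, h, h'⟩ => by
      obtain ⟨y, hy⟩ := y; subst h; exact ⟨hy, h'⟩⟩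
  rw [hgr]
  -- Finite partial sums of the basis expansion lie in the graph by `hT`, and they converge together
  -- with their images; closedness of the graph gives the limit.
  have fwd : ∀ v z : E, (∀ i, lam i * inner ℝ (e i) v = inner ℝ (e i) z) →
      (T v, T (z + N v)) ∈ A.graph := by
    intro v z hz
    have hv := e.hasSum_repr v
    have hz' := e.hasSum_repr z
    have hsum := (hv.mapL (T : E →L[ℝ] E)).prodMk
      ((hz'.add (hv.mapL N)).mapL (T : E →L[ℝ] E))
    have hcl : IsClosed (A.graph : Set (E × E)) := hA
    refine hcl.mem_of_tendsto hsum (Eventually.of_forall fun s => ?_)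
    refine Submodule.sum_mem _ fun i _ => ?_
    have := A.graph.smul_mem (inner ℝ (e i) v) (hT i)
    convert this using 1
    rw [Prod.smul_mk]
    simp only [e.repr_apply_apply, ← hz i, ContinuousLinearEquiv.coe_coe, map_add, map_smul,
      smul_add, smul_smul, mul_comm]
  constructor
  · intro hi
    have := fwd _ _ hi
    simpa using this
  · intro hu
    have hpos : ∀ i, 0 < l₀ - lam i := fun i => by linarith [h i]
    have hb : ∀ i, |(l₀ - lam i)⁻¹| ≤ (l₀ - om)⁻¹ := fun i => by
      rw [abs_of_pos (inv_pos.mpr (hpos i))]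
      exact inv_anti₀ (by linarith) (by linarith [h i])
    set R := diagOp e _ _ hb with hR
    set y := T.symm (l₀ • u - w) with hy
    have hRN : ∀ x, N (R x) = R (N x) :=
      diagOp_comm e hb (fun i j hij => by rw [hij]) hN
    -- With R = (l₀ − G)⁻¹, this v solves (l₀ − G − N)v = y: the Neumann series for the resolvent
    -- ends here because N² = 0 and NR = RN. Then u and Tv have the same image under l₀ − A, and
    -- injectivity forces u = Tv.
    set v := R y + R (N (R y)) with hv
    have hNv : N v = N (R y) := by
      rw [hv, map_add, hRN (N (R y)), hNN, map_zero, add_zero]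
    have hvi : ∀ i, lam i * inner ℝ (e i) v = inner ℝ (e i) (l₀ • v - y - N v) := fun i => by
      have e1 : (l₀ - lam i) * inner ℝ (e i) v = inner ℝ (e i) y + inner ℝ (e i) (N v) := by
        rw [hNv, hv, inner_add_right, inner_diagOp, inner_diagOp]
        have := (hpos i).ne'
        field_simp
      rw [inner_sub_right, inner_sub_right, inner_smul_right]
      linarith
    have hg := fwd v _ hvi
    rw [sub_add_cancel, map_sub, map_smul, hy, T.apply_symm_apply] at hg
    have hd := A.graph.sub_mem hu hg
    have e2 : ((u, w) : E × E) - (T v, l₀ • T v - (l₀ • u - w)) =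
        (u - T v, l₀ • (u - T v)) := by
      rw [Prod.mk_sub_mk, smul_sub]
      congr 1
      abel
    rw [e2] at hd
    have huv : u = T v := sub_eq_zero.mp (hinj _ hd)
    intro i
    have hTu : T.symm u = v := by rw [huv, T.symm_apply_apply]
    rw [hTu, hvi i]
    congr 2
    rw [hy, map_sub, map_smul, hTu]
    abel

end Generation

/-! ### Primitives and weak derivatives on `(0,1)` -/

instance : IsProbabilityMeasure mu01 := ⟨by simp⟩

theorem integrable_L2 (h : L2) : Integrable h mu01 := (Lp.memLp h).integrable (by norm_num)

theorem coeFn_toL2 {F : ℝ → ℝ} (hF : Continuous F) : toL2 F hF =ᵐ[mu01] F :=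
  MemLp.coeFn_toLp _

theorem toL2_eq {F : ℝ → ℝ} (hF : Continuous F) {h : L2} (hh : h =ᵐ[mu01] F) : h = toL2 F hF :=
  Lp.ext (hh.trans (coeFn_toL2 hF).symm)

theorem inner_toL2 {F : ℝ → ℝ} (hF : Continuous F) (h : L2) :
    inner ℝ (toL2 F hF) h = ∫ x in Ioo (0 : ℝ) 1, F x * h x := by
  rw [L2.inner_def]
  refine integral_congr_ae ?_
  filter_upwards [coeFn_toL2 hF] with x hx
  rw [hx]
  simp [mul_comm]

theorem inner_toL2_toL2 {F G : ℝ → ℝ} (hF : Continuous F) (hG : Continuous G) :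
    inner ℝ (toL2 F hF) (toL2 G hG) = ∫ x in (0 : ℝ)..1, F x * G x := by
  rw [inner_toL2, intervalIntegral.integral_of_le zero_le_one, integral_Ioc_eq_integral_Ioo]
  refine integral_congr_ae ?_
  filter_upwards [coeFn_toL2 hG] with x hx
  rw [hx]

/-- The constant function `1`. -/
def one : L2 := toL2 (fun _ => 1) continuous_const

theorem inner_one (h : L2) : inner ℝ one h = ∫ x in Ioo (0 : ℝ) 1, h x := by
  simp [one, inner_toL2]

theorem inner_one_one : inner ℝ one one = 1 := by
  rw [one, inner_toL2_toL2]
  simp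

/-- The primitive of `h` that vanishes at `0`. -/
def prim (h : L2) (x : ℝ) : ℝ := ∫ y in (0 : ℝ)..x, (Ioo (0 : ℝ) 1).indicator h y

theorem integrable_indicator_L2 (h : L2) : Integrable ((Ioo (0 : ℝ) 1).indicator h) :=
  (integrable_indicator_iff measurableSet_Ioo).mpr (integrable_L2 h)

theorem continuous_prim (h : L2) : Continuous (prim h) :=
  (integrable_indicator_L2 h).continuous_primitive 0

theorem continuous_const_add_prim (c : ℝ) (h : L2) : Continuous fun x => c + prim h x :=
  continuous_const.add (continuous_prim h)

theorem prim_zero (h : L2) : prim h 0 = 0 := intervalIntegral.integral_same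

theorem intervalIntegral_zero_one (F : ℝ → ℝ) :
    ∫ x in (0 : ℝ)..1, F x = ∫ x in Ioo (0 : ℝ) 1, F x := by
  rw [intervalIntegral.integral_of_le zero_le_one, integral_Ioc_eq_integral_Ioo]

theorem prim_one (h : L2) : prim h 1 = inner ℝ one h := by
  rw [prim, intervalIntegral_zero_one, inner_one]
  exact setIntegral_congr_fun measurableSet_Ioo fun x hx => indicator_of_mem hx _

/-- On a probability space the L¹ norm is at most the L² norm; this makes the Volterra operator
bounded. -/
theorem abs_prim_le (h : L2) (x : ℝ) : |prim h x| ≤ ‖h‖ := by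
  have h1 : |prim h x| ≤ ∫ y, ‖(Ioo (0 : ℝ) 1).indicator h y‖ :=
    (intervalIntegral.norm_integral_le_integral_norm_uIoc).trans
      (setIntegral_le_integral (integrable_indicator_L2 h).norm
        (Eventually.of_forall fun y => norm_nonneg _))
  refine h1.trans ?_
  simp_rw [norm_indicator_eq_indicator_norm]
  rw [integral_indicator measurableSet_Ioo, integral_norm_eq_lintegral_enorm
    (Lp.aestronglyMeasurable h), Lp.norm_def]
  refine ENNReal.toReal_mono (Lp.eLpNorm_ne_top h) ?_
  rw [← eLpNorm_one_eq_lintegral_enorm]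
  exact eLpNorm_le_eLpNorm_of_exponent_le (by norm_num) (Lp.aestronglyMeasurable h)

theorem prim_congr {h : L2} {F : ℝ → ℝ} (hF : h =ᵐ[mu01] F) (x : ℝ) :
    prim h x = ∫ y in (0 : ℝ)..x, (Ioo (0 : ℝ) 1).indicator F y := by
  refine intervalIntegral.integral_congr_ae ?_
  rw [EventuallyEq, ae_restrict_iff' measurableSet_Ioo] at hF
  filter_upwards [hF] with y hy _
  by_cases hm : y ∈ Ioo (0 : ℝ) 1
  · rw [indicator_of_mem hm, indicator_of_mem hm, hy hm]
  · rw [indicator_of_notMem hm, indicator_of_notMem hm]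

theorem prim_add (h k : L2) (x : ℝ) : prim (h + k) x = prim h x + prim k x := by
  rw [prim_congr (Lp.coeFn_add h k), indicator_add', prim, prim]
  exact intervalIntegral.integral_add (integrable_indicator_L2 h).intervalIntegrable
    (integrable_indicator_L2 k).intervalIntegrable

theorem prim_smul (c : ℝ) (h : L2) (x : ℝ) : prim (c • h) x = c * prim h x := by
  rw [prim_congr (Lp.coeFn_smul c h), prim, ← intervalIntegral.integral_const_mul]
  congr 1
  funext y
  by_cases hm : y ∈ Ioo (0 : ℝ) 1 <;> simp [hm]

theorem toL2_add {F G : ℝ → ℝ} (hF : Continuous F) (hG : Continuous G) :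
    toL2 F hF + toL2 G hG = toL2 (fun x => F x + G x) (hF.add hG) :=
  toL2_eq _ ((Lp.coeFn_add _ _).trans ((coeFn_toL2 hF).add (coeFn_toL2 hG)))

theorem toL2_smul (c : ℝ) {F : ℝ → ℝ} (hF : Continuous F) :
    c • toL2 F hF = toL2 (fun x => c * F x) (continuous_const.mul hF) :=
  toL2_eq _ ((Lp.coeFn_smul _ _).trans ((coeFn_toL2 hF).const_smul c))

theorem toL2_congr {F G : ℝ → ℝ} (hF : Continuous F) (hG : Continuous G) (h : ∀ x, F x = G x) :
    toL2 F hF = toL2 G hG := by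
  obtain rfl : F = G := funext h
  rfl

/-- The Volterra operator. -/
def volterra : L2 →L[ℝ] L2 :=
  LinearMap.mkContinuous
    { toFun := fun h => toL2 (prim h) (continuous_prim h)
      map_add' := fun h k => by
        rw [toL2_add]
        exact toL2_congr _ _ (prim_add h k)
      map_smul' := fun c h => by
        rw [RingHom.id_apply, toL2_smul]
        exact toL2_congr _ _ (prim_smul c h) } 1 (by
      intro h
      have := Lp.norm_le_of_ae_bound (f := toL2 (prim h) (continuous_prim h)) (norm_nonneg h) (by
        filter_upwards [coeFn_toL2 (continuous_prim h)] with x hx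
        rw [hx]
        exact abs_prim_le h x)
      simpa [measureUnivNNReal] using this)

theorem const_add_volterra (c : ℝ) (h : L2) : c • one + volterra h =
    toL2 (fun x => c + prim h x) (continuous_const_add_prim c h) := by
  change c • one + toL2 (prim h) (continuous_prim h) = _
  rw [one, toL2_smul, toL2_add]
  exact toL2_congr _ _ fun x => by ring

/-- Integration by parts. -/
theorem inner_deriv_const_add_volterra {ψ ψ' : ℝ → ℝ} (hψ : ∀ x, HasDerivAt ψ (ψ' x) x)
    (hc : Continuous ψ) (hc' : Continuous ψ') (c : ℝ) (h : L2) :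
    inner ℝ (toL2 ψ' hc') (c • one + volterra h) =
      (c + inner ℝ one h) * ψ 1 - c * ψ 0 - inner ℝ (toL2 ψ hc) h := by
  have hd : deriv ψ = ψ' := funext fun x => (hψ x).deriv
  have hψ1 : ContDiff ℝ 1 ψ :=
    contDiff_one_iff_deriv.mpr ⟨fun x => (hψ x).differentiableAt, hd ▸ hc'⟩
  have hi : IntervalIntegrable ((Ioo (0 : ℝ) 1).indicator h) volume 0 1 :=
    (integrable_indicator_L2 h).intervalIntegrable
  -- The primitive of an integrable function is absolutely continuous, so the classical product
  -- formula applies although h is only in L².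
  have hac := hi.absolutelyContinuousOnInterval_intervalIntegral (c := 0) (by simp)
  have hparts := hac.integral_mul_deriv_eq_deriv_mul hψ1.contDiffOn.absolutelyContinuousOnInterval
  have e1 : ∫ x in (0 : ℝ)..1, deriv (prim h) x * ψ x = inner ℝ (toL2 ψ hc) h := by
    rw [inner_toL2, ← intervalIntegral_zero_one]
    -- The interval integral runs over (0, 1], but the indicator vanishes at 1.
    have : ∀ᵐ x : ℝ, x ≠ 1 := by simp [ae_iff]
    refine intervalIntegral.integral_congr_ae ?_
    filter_upwards [hi.ae_hasDerivAt_integral, this] with x hx hx1 hxm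
    have hd : HasDerivAt (prim h) _ x := hx (uIoc_subset_uIcc hxm) 0 (by simp)
    rw [uIoc_of_le zero_le_one] at hxm
    rw [hd.deriv, indicator_of_mem (show x ∈ Ioo (0 : ℝ) 1 from ⟨hxm.1, lt_of_le_of_ne hxm.2 hx1⟩),
      mul_comm]
  have e2 : ∫ x in (0 : ℝ)..1, prim h x * ψ' x =
      prim h 1 * ψ 1 - prim h 0 * ψ 0 - ∫ x in (0 : ℝ)..1, deriv (prim h) x * ψ x := by
    rw [← hd]; exact hparts
  have e3 : ∫ x in (0 : ℝ)..1, ψ' x = ψ 1 - ψ 0 :=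
    intervalIntegral.integral_eq_sub_of_hasDerivAt (fun x _ => hψ x) (hc'.intervalIntegrable _ _)
  have e4 : ∫ x in (0 : ℝ)..1, ψ' x * (c + prim h x) =
      c * (∫ x in (0 : ℝ)..1, ψ' x) + ∫ x in (0 : ℝ)..1, prim h x * ψ' x := by
    rw [← intervalIntegral.integral_const_mul, ← intervalIntegral.integral_add]
    · congr 1
      funext x
      ring
    · exact (continuous_const.mul hc').intervalIntegrable _ _
    · exact ((continuous_prim h).mul hc').intervalIntegrable _ _
  rw [const_add_volterra, inner_toL2_toL2, e4, e3, e2, e1, prim_zero, prim_one]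
  ring

theorem inner_toL2_comm {φ : ℝ → ℝ} (hφ : Continuous φ) (h : L2) :
    inner ℝ (toL2 φ hφ) h = ∫ x in Ioo (0 : ℝ) 1, h x * φ x := by
  rw [inner_toL2]
  congr 1
  funext x
  ring

theorem isWeakDeriv_iff_inner {f g : L2} : IsWeakDeriv f g ↔
    ∀ (φ : ℝ → ℝ) (h1 : ContDiff ℝ ∞ φ), HasCompactSupport φ → tsupport φ ⊆ Ioo (0 : ℝ) 1 →
      inner ℝ (toL2 (deriv φ) (h1.continuous_deriv (by simp))) f =
        -inner ℝ (toL2 φ h1.continuous) g := by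
  simp_rw [inner_toL2_comm]
  exact Iff.rfl

theorem isWeakDeriv_const_add_volterra (c : ℝ) (h : L2) :
    IsWeakDeriv (c • one + volterra h) h := by
  rw [isWeakDeriv_iff_inner]
  intro φ h1 h2 h3
  have hz : ∀ x, x ∉ Ioo (0 : ℝ) 1 → φ x = 0 := fun x hx =>
    image_eq_zero_of_notMem_tsupport fun hx' => hx (h3 hx')
  rw [inner_deriv_const_add_volterra
    (fun x => (h1.differentiable (by simp) x).hasDerivAt) h1.continuous, hz 0 (by simp),
    hz 1 (by simp)]
  ring

/-- A test function on `(0,1)` with mean value zero is the derivative of a test function. -/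
theorem exists_deriv_eq {θ : ℝ → ℝ} (h1 : ContDiff ℝ ∞ θ) (h2 : HasCompactSupport θ)
    (h3 : tsupport θ ⊆ Ioo (0 : ℝ) 1) (h0 : ∫ x in Ioo (0 : ℝ) 1, θ x = 0) :
    ∃ φ : ℝ → ℝ, ContDiff ℝ ∞ φ ∧ HasCompactSupport φ ∧ tsupport φ ⊆ Ioo (0 : ℝ) 1 ∧
      deriv φ = θ := by
  obtain ⟨α, β, hα, hβ, hs⟩ : ∃ α β : ℝ, 0 < α ∧ β < 1 ∧ tsupport θ ⊆ Icc α β := by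
    rcases (tsupport θ).eq_empty_or_nonempty with he | hne
    -- For empty support, `Icc 1 0` is empty and still meets the bounds 0 < α and β < 1.
    · exact ⟨1, 0, one_pos, one_pos, by simp [he]⟩
    · obtain ⟨α, hα, hα'⟩ := h2.isCompact.exists_isLeast hne
      obtain ⟨β, hβ, hβ'⟩ := h2.isCompact.exists_isGreatest hne
      exact ⟨α, β, (h3 hα).1, (h3 hβ).2, fun x hx => ⟨hα' hx, hβ' hx⟩⟩
  have hz : ∀ x, x ∉ Icc α β → θ x = 0 := fun x hx =>
    image_eq_zero_of_notMem_tsupport fun hx' => hx (hs hx')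
  have hd : ∀ x, HasDerivAt (fun x => ∫ y in (0 : ℝ)..x, θ y) (θ x) x := fun x =>
    intervalIntegral.integral_hasDerivAt_right (h1.continuous.intervalIntegrable _ _)
      (h1.continuous.stronglyMeasurableAtFilter _ _) h1.continuous.continuousAt
  have hderiv : deriv (fun x => ∫ y in (0 : ℝ)..x, θ y) = θ := funext fun x => (hd x).deriv
  have hsupp : tsupport (fun x => ∫ y in (0 : ℝ)..x, θ y) ⊆ Icc α β := by
    refine closure_minimal (fun x hx => ?_) isClosed_Icc
    by_contra hxn
    refine hx ?_
    rcases lt_or_ge x α with hxa | hxa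
    · refine intervalIntegral.integral_zero_ae (Eventually.of_forall fun y hy => hz y fun hy' => ?_)
      rcases le_total 0 x with h | h
      · rw [uIoc_of_le h] at hy
        linarith [hy.2, hy'.1]
      · rw [uIoc_of_ge h] at hy
        linarith [hy.2, hy'.1]
    · have hxb : β < x := not_le.mp fun h => hxn ⟨hxa, h⟩
      -- To the right of the support, the primitive is the total integral, which is zero, minus this
      -- vanishing tail.
      have e1 : ∫ y in x..1, θ y = 0 := by
        refine intervalIntegral.integral_zero_ae
          (Eventually.of_forall fun y hy => hz y fun hy' => ?_)
        rcases le_total x 1 with h | h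
        · rw [uIoc_of_le h] at hy
          linarith [hy.1, hy'.2]
        · rw [uIoc_of_ge h] at hy
          linarith [hy.1, hy'.2]
      have e2 := intervalIntegral.integral_add_adjacent_intervals
        (h1.continuous.intervalIntegrable (μ := volume) 0 x)
        (h1.continuous.intervalIntegrable x 1)
      rw [intervalIntegral_zero_one, h0, e1, add_zero] at e2
      exact e2
  refine ⟨fun x => ∫ y in (0 : ℝ)..x, θ y, ?_, ?_, ?_, hderiv⟩
  · exact contDiff_infty_iff_deriv.mpr ⟨fun x => (hd x).differentiableAt, by rw [hderiv]; exact h1⟩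
  · exact isCompact_Icc.of_isClosed_subset (isClosed_tsupport _) hsupp
  · exact hsupp.trans fun x hx => ⟨hα.trans_le hx.1, hx.2.trans_lt hβ⟩

/-- An element of `L²(0,1)` that is orthogonal to all test functions is zero. -/
theorem eq_zero_of_inner_test {h : L2}
    (hh : ∀ (φ : ℝ → ℝ) (h1 : ContDiff ℝ ∞ φ), HasCompactSupport φ →
      tsupport φ ⊆ Ioo (0 : ℝ) 1 → inner ℝ (toL2 φ h1.continuous) h = 0) : h = 0 := by
  -- Orthogonality to all test functions says exactly that h is a weak derivative of 0.
  refine (IsWeakDeriv.unique (f := 0) ?_ isWeakDeriv_zero)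
  rw [isWeakDeriv_iff_inner]
  intro φ h1 h2 h3
  rw [hh φ h1 h2 h3, inner_zero_right, neg_zero]

/-- The lemma of du Bois-Reymond. -/
theorem IsWeakDeriv.eq_const {d : L2} (hd : IsWeakDeriv d 0) : ∃ c : ℝ, d = c • one := by
  rw [isWeakDeriv_iff_inner] at hd
  let b : ContDiffBump (1 / 2 : ℝ) := ⟨1 / 8, 1 / 4, by norm_num, by norm_num⟩
  set ρ := b.normed volume with hρ
  have r1 : ContDiff ℝ ∞ ρ := b.contDiff_normed
  have r2 : HasCompactSupport ρ := b.hasCompactSupport_normed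
  have r3 : tsupport ρ ⊆ Ioo (0 : ℝ) 1 := by
    rw [hρ, b.tsupport_normed_eq, Real.closedBall_eq_Icc]
    intro x hx
    have : b.rOut = 1 / 4 := rfl
    rw [this] at hx
    exact ⟨by linarith [hx.1], by linarith [hx.2]⟩
  have r4 : ∫ x in Ioo (0 : ℝ) 1, ρ x = 1 := by
    rw [setIntegral_eq_integral_of_forall_compl_eq_zero fun x hx =>
      image_eq_zero_of_notMem_tsupport fun hx' => hx (r3 hx'), hρ, b.integral_normed]
  -- The constant is the mean of d against the bump ρ. For a test function η with integral m, η − mρ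
  -- has mean zero and so is the derivative of a test function; d annihilates it, whence ⟨η, d⟩ =
  -- m⟨ρ, d⟩.
  refine ⟨inner ℝ (toL2 ρ r1.continuous) d, sub_eq_zero.mp (eq_zero_of_inner_test ?_)⟩
  intro η h1 h2 h3
  set m := ∫ x in Ioo (0 : ℝ) 1, η x with hm
  have hsub : tsupport (fun x => η x + -m * ρ x) ⊆ tsupport η ∪ tsupport ρ := by
    refine (tsupport_add _ _).trans (union_subset_union_right _ ?_)
    exact tsupport_mul_subset_right
  have hcs : HasCompactSupport (fun x => η x + -m * ρ x) := h2.add r2.mul_left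
  have hcd : ContDiff ℝ ∞ (fun x => η x + -m * ρ x) := h1.add (contDiff_const.mul r1)
  have hi : ∀ {F : ℝ → ℝ}, Continuous F → Integrable F mu01 := fun hF =>
    (memLp_of_continuous hF).integrable (by norm_num)
  obtain ⟨φ, p1, p2, p3, p4⟩ := exists_deriv_eq hcd hcs (hsub.trans (union_subset h3 r3)) (by
    rw [integral_add (hi h1.continuous) ((hi r1.continuous).const_mul _), integral_const_mul, r4,
      ← hm]
    ring)
  have key := hd φ p1 p2 p3
  have e1 : toL2 (deriv φ) (p1.continuous_deriv (by simp)) =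
      toL2 η h1.continuous + (-m) • toL2 ρ r1.continuous := by
    rw [toL2_smul, toL2_add]
    exact toL2_congr _ _ fun x => by rw [p4]
  have e2 : inner ℝ (toL2 η h1.continuous) one = m := by
    rw [real_inner_comm, inner_one, hm]
    exact integral_congr_ae (coeFn_toL2 _)
  rw [inner_zero_right, neg_zero, e1, inner_add_left, inner_smul_left] at key
  rw [inner_sub_right, inner_smul_right, e2]
  simp only [RCLike.conj_to_real] at key
  linarith

/-- The difference of f and the primitive of h has weak derivative zero, hence is constant. This
replaces Sobolev functions by explicit primitives, whose traces can be read off. -/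
theorem isWeakDeriv_iff {f h : L2} :
    IsWeakDeriv f h ↔ ∃ c : ℝ, f = c • one + volterra h := by
  constructor
  · intro hf
    have h1 := (isWeakDeriv_const_add_volterra 0 h).smul (-1)
    have h2 := hf.add h1
    rw [neg_one_smul, neg_one_smul, add_neg_cancel, zero_smul, zero_add] at h2
    obtain ⟨c, hc⟩ := h2.eq_const
    exact ⟨c, by rw [← hc]; abel⟩
  · rintro ⟨c, rfl⟩
    exact isWeakDeriv_const_add_volterra c h

theorem hasTrace_toL2 {F : ℝ → ℝ} (hF : Continuous F) (x : ℝ) : HasTrace (toL2 F hF) x (F x) :=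
  ⟨F, hF.continuousOn, coeFn_toL2 hF, rfl⟩

theorem HasTrace.unique {f : L2} {x v w : ℝ} (hx : x ∈ Icc (0 : ℝ) 1) (hv : HasTrace f x v)
    (hw : HasTrace f x w) : v = w := by
  obtain ⟨F, h1, h2, rfl⟩ := hv
  obtain ⟨G, h1', h2', rfl⟩ := hw
  refine Measure.eqOn_Icc_of_ae_eq volume zero_ne_one ?_ h1 h1' hx
  rw [← restrict_Ioo_eq_restrict_Icc]
  exact h2.symm.trans h2'

theorem hasTrace_zero_iff {c v : ℝ} {h : L2} : HasTrace (c • one + volterra h) 0 v ↔ v = c := by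
  have h1 := hasTrace_toL2 (continuous_const_add_prim c h) 0
  rw [← const_add_volterra, prim_zero, add_zero] at h1
  exact ⟨fun hv => hv.unique (by simp) h1, fun hv => hv ▸ h1⟩

theorem hasTrace_one_iff {c v : ℝ} {h : L2} :
    HasTrace (c • one + volterra h) 1 v ↔ v = c + inner ℝ one h := by
  have h1 := hasTrace_toL2 (continuous_const_add_prim c h) 1
  rw [← const_add_volterra, prim_one] at h1
  exact ⟨fun hv => hv.unique (by simp) h1, fun hv => hv ▸ h1⟩

theorem isWeakDeriv_toL2 {F F' : ℝ → ℝ} (hF : Continuous F) (hF' : Continuous F')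
    (h : ∀ x, HasDerivAt F (F' x) x) : IsWeakDeriv (toL2 F hF) (toL2 F' hF') := by
  refine isWeakDeriv_iff.mpr ⟨F 0, ?_⟩
  rw [const_add_volterra]
  refine Lp.ext ?_
  filter_upwards [coeFn_toL2 hF, coeFn_toL2 (continuous_const_add_prim (F 0) (toL2 F' hF')),
    ae_restrict_mem measurableSet_Ioo]
    with x h1 h2 hx
  rw [h1, h2, prim_congr (coeFn_toL2 hF')]
  have e1 : ∫ y in (0 : ℝ)..x, (Ioo (0 : ℝ) 1).indicator F' y = ∫ y in (0 : ℝ)..x, F' y := by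
    refine intervalIntegral.integral_congr_ae (Eventually.of_forall fun y hy => ?_)
    rw [uIoc_of_le hx.1.le] at hy
    exact indicator_of_mem (show y ∈ Ioo (0 : ℝ) 1 from ⟨hy.1, hy.2.trans_lt hx.2⟩) _
  rw [e1, intervalIntegral.integral_eq_sub_of_hasDerivAt (fun x _ => h x)
    (hF'.intervalIntegrable _ _)]
  ring

/-! ### The graph of the coupled operator -/

/-- Both components are double primitives, and the boundary conditions become conditions on
integration constants: c = g(0), d = f(0), while g'(0) = 0 and f'(0) = sc fix the inner constants.
The two scalar equations are g'(1) = 0 and f(1) = 0. No weak derivative remains, only bounded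
operators. -/
theorem mem_graph_coupledOp_iff {a b s : ℝ} {u w : H0} :
    (u, w) ∈ (coupledOp a b s).graph ↔ ∃ c d : ℝ,
      inner ℝ one (w.snd - b • u.snd) = 0 ∧
      u.snd = c • one + volterra (volterra (w.snd - b • u.snd)) ∧
      d + inner ℝ one ((s * c) • one + volterra (w.fst - a • u.fst)) = 0 ∧
      u.fst = d • one + volterra ((s * c) • one + volterra (w.fst - a • u.fst)) := by
  rw [LinearPMap.mem_graph_iff]
  constructor
  · rintro ⟨⟨y, hy⟩, rfl, hw⟩
    obtain ⟨hf, hg, h1, h2, h3, c, h4, h5⟩ := hy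
    have hw : WithLp.toLp 2 (weakDeriv (weakDeriv y.fst) + a • y.fst,
      weakDeriv (weakDeriv y.snd) + b • y.snd) = w := hw
    subst hw
    have hp : (WithLp.toLp 2 (weakDeriv (weakDeriv y.fst) + a • y.fst,
      weakDeriv (weakDeriv y.snd) + b • y.snd) : H0).fst - a • y.fst =
      weakDeriv (weakDeriv y.fst) := add_sub_cancel_right _ _
    have hq : (WithLp.toLp 2 (weakDeriv (weakDeriv y.fst) + a • y.fst,
      weakDeriv (weakDeriv y.snd) + b • y.snd) : H0).snd - b • y.snd =
      weakDeriv (weakDeriv y.snd) := add_sub_cancel_right _ _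
    rw [hp, hq]
    obtain ⟨d, hd⟩ := isWeakDeriv_iff.mp hf.isWeakDeriv
    obtain ⟨d', hd'⟩ := isWeakDeriv_iff.mp hf.isWeakDeriv₂
    obtain ⟨e, he⟩ := isWeakDeriv_iff.mp hg.isWeakDeriv
    obtain ⟨e', he'⟩ := isWeakDeriv_iff.mp hg.isWeakDeriv₂
    rw [hd, hasTrace_one_iff] at h1
    rw [he', hasTrace_zero_iff] at h2
    rw [he', hasTrace_one_iff] at h3
    rw [he, hasTrace_zero_iff] at h4
    rw [hd', hasTrace_zero_iff] at h5
    subst h4 h2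
    rw [zero_smul, zero_add] at he'
    rw [← h5] at hd'
    refine ⟨c, d, ?_, ?_, ?_, ?_⟩
    · linarith
    · rw [← he']; exact he
    · rw [← hd']; exact h1.symm
    · rw [← hd']; exact hd
  · rintro ⟨c, d, h1, h2, h3, h4⟩
    set q := w.snd - b • u.snd with hq
    set p := w.fst - a • u.fst with hp
    have g1 : IsWeakDeriv u.snd (volterra q) := isWeakDeriv_iff.mpr ⟨c, h2⟩
    have g2' : volterra q = (0 : ℝ) • one + volterra q := by rw [zero_smul, zero_add]
    have g2 : IsWeakDeriv (volterra q) q := isWeakDeriv_iff.mpr ⟨0, g2'⟩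
    have f1 : IsWeakDeriv u.fst ((s * c) • one + volterra p) := isWeakDeriv_iff.mpr ⟨d, h4⟩
    have f2 : IsWeakDeriv ((s * c) • one + volterra p) p := isWeakDeriv_iff.mpr ⟨_, rfl⟩
    refine ⟨⟨u, ⟨_, _, f1, f2⟩, ⟨_, _, g1, g2⟩, ?_, ?_, ?_, c, ?_, ?_⟩, rfl, ?_⟩
    · rw [h4, hasTrace_one_iff, h3]
    · rw [g1.eq, g2', hasTrace_zero_iff]
    · rw [g1.eq, g2', hasTrace_one_iff, h1, zero_add]
    · rw [h2, hasTrace_zero_iff]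
    · rw [f1.eq, hasTrace_zero_iff]
    · change WithLp.toLp 2 (weakDeriv (weakDeriv u.fst) + a • u.fst,
        weakDeriv (weakDeriv u.snd) + b • u.snd) = w
      rw [f1.eq, f2.eq, g1.eq, g2.eq, hp, hq, sub_add_cancel, sub_add_cancel]
      rfl

/-- Pairing with the unit vector `one` recovers c and d as continuous functions of (u, w). The
existential quantifiers disappear and the graph is an intersection of sets where continuous maps
agree. -/
theorem isClosed_coupledOp (a b s : ℝ) : (coupledOp a b s).IsClosed := by
  have hcont1 : Continuous fun p : H0 × H0 => p.2.snd - b • p.1.snd := by fun_prop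
  have hcont2 : Continuous fun p : H0 × H0 => p.2.fst - a • p.1.fst := by fun_prop
  have hc : Continuous fun p : H0 × H0 =>
      (inner ℝ one (p.1.snd - volterra (volterra (p.2.snd - b • p.1.snd))) : ℝ) := by fun_prop
  set C : H0 × H0 → ℝ := fun p =>
    inner ℝ one (p.1.snd - volterra (volterra (p.2.snd - b • p.1.snd))) with hC
  have hd : Continuous fun p : H0 × H0 => (inner ℝ one
      (p.1.fst - volterra ((s * C p) • one + volterra (p.2.fst - a • p.1.fst))) : ℝ) := by
    fun_prop
  set D : H0 × H0 → ℝ := fun p => inner ℝ one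
    (p.1.fst - volterra ((s * C p) • one + volterra (p.2.fst - a • p.1.fst))) with hD
  have hset : ((coupledOp a b s).graph : Set (H0 × H0)) =
      {p | inner ℝ one (p.2.snd - b • p.1.snd) = 0} ∩
      ({p | p.1.snd = C p • one + volterra (volterra (p.2.snd - b • p.1.snd))} ∩
      ({p | D p + inner ℝ one ((s * C p) • one + volterra (p.2.fst - a • p.1.fst)) = 0} ∩
      {p | p.1.fst = D p • one +
        volterra ((s * C p) • one + volterra (p.2.fst - a • p.1.fst))})) := by
    ext ⟨u, w⟩
    rw [SetLike.mem_coe, mem_graph_coupledOp_iff]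
    constructor
    · rintro ⟨c, d, h1, h2, h3, h4⟩
      have hcC : C (u, w) = c := by
        change inner ℝ one (u.snd - volterra (volterra (w.snd - b • u.snd))) = c
        rw [sub_eq_iff_eq_add.mpr h2, inner_smul_right, inner_one_one, mul_one]
      have hdD : D (u, w) = d := by
        change inner ℝ one (u.fst -
          volterra ((s * C (u, w)) • one + volterra (w.fst - a • u.fst))) = d
        rw [hcC, sub_eq_iff_eq_add.mpr h4, inner_smul_right, inner_one_one, mul_one]
      simp only [mem_inter_iff, mem_ofPred_eq, hcC, hdD]
      exact ⟨h1, h2, h3, h4⟩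
    · rintro ⟨h1, h2, h3, h4⟩
      exact ⟨C (u, w), D (u, w), h1, h2, h3, h4⟩
  change IsClosed ((coupledOp a b s).graph : Set (H0 × H0))
  rw [hset]
  refine (isClosed_eq (by fun_prop) continuous_const).inter ((isClosed_eq (by fun_prop)
    (by fun_prop)).inter ((isClosed_eq (by fun_prop) continuous_const).inter
    (isClosed_eq (by fun_prop) (by fun_prop))))

/-! ### Cosine bases -/

theorem integrable_continuous_mul {F k : ℝ → ℝ} (hF : Continuous F) (hk : Integrable k mu01) :
    Integrable (fun x => F x * k x) mu01 := by
  obtain ⟨C, hC⟩ := isCompact_Icc.exists_bound_of_continuousOn (s := Icc (0 : ℝ) 1)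
    hF.continuousOn
  refine hk.bdd_mul (c := C) hF.aestronglyMeasurable ?_
  filter_upwards [ae_restrict_mem measurableSet_Ioo] with x hx
  exact hC x (Ioo_subset_Icc_self hx)

theorem integral_cos_int_mul_eq_zero {k : ℝ → ℝ}
    (h : ∀ m : ℕ, ∫ x in Ioo (0 : ℝ) 1, Real.cos (m * Real.pi * x) * k x = 0) (m : ℤ) :
    ∫ x in Ioo (0 : ℝ) 1, Real.cos (m * Real.pi * x) * k x = 0 := by
  rcases Int.eq_nat_or_neg m with ⟨n, rfl | rfl⟩
  · exact_mod_cast h n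
  · refine Eq.trans ?_ (h n)
    congr 1
    funext x
    rw [Int.cast_neg, Int.cast_natCast, neg_mul, neg_mul, Real.cos_neg]

/-- Induction on the power by the product-to-sum formula. Integer frequencies are needed since m − 1
may be negative. -/
theorem integral_cos_pow_mul_eq_zero {k : ℝ → ℝ} (hk : Integrable k mu01)
    (h : ∀ m : ℕ, ∫ x in Ioo (0 : ℝ) 1, Real.cos (m * Real.pi * x) * k x = 0) (j : ℕ) :
    ∀ m : ℤ, ∫ x in Ioo (0 : ℝ) 1,
      (Real.cos (Real.pi * x) ^ j * Real.cos (m * Real.pi * x)) * k x = 0 := by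
  induction j with
  | zero =>
    intro m
    simpa using integral_cos_int_mul_eq_zero h m
  | succ j ih =>
    intro m
    have e : ∀ x : ℝ, (Real.cos (Real.pi * x) ^ (j + 1) * Real.cos (m * Real.pi * x)) * k x =
        1 / 2 * ((Real.cos (Real.pi * x) ^ j * Real.cos ((m + 1 : ℤ) * Real.pi * x)) * k x +
          (Real.cos (Real.pi * x) ^ j * Real.cos ((m - 1 : ℤ) * Real.pi * x)) * k x) := by
      intro x
      have e1 : ((m + 1 : ℤ) : ℝ) * Real.pi * x = m * Real.pi * x + Real.pi * x := by
        push_cast; ring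
      have e2 : ((m - 1 : ℤ) : ℝ) * Real.pi * x = m * Real.pi * x - Real.pi * x := by
        push_cast; ring
      rw [e1, e2, Real.cos_add, Real.cos_sub]
      ring
    simp_rw [e]
    rw [integral_const_mul, integral_add (integrable_continuous_mul (by fun_prop) hk)
      (integrable_continuous_mul (by fun_prop) hk), ih, ih]
    simp

theorem integral_polynomial_cos_mul_eq_zero {k : ℝ → ℝ} (hk : Integrable k mu01)
    (h : ∀ m : ℕ, ∫ x in Ioo (0 : ℝ) 1, Real.cos (m * Real.pi * x) * k x = 0)
    (p : Polynomial ℝ) : ∫ x in Ioo (0 : ℝ) 1, p.eval (Real.cos (Real.pi * x)) * k x = 0 := by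
  simp_rw [Polynomial.eval_eq_sum_range, Finset.sum_mul, mul_assoc]
  rw [integral_finsetSum]
  · refine Finset.sum_eq_zero fun j _ => ?_
    rw [integral_const_mul]
    have := integral_cos_pow_mul_eq_zero hk h j 0
    simp only [Int.cast_zero, zero_mul, Real.cos_zero, mul_one] at this
    rw [this, mul_zero]
  · intro j _
    exact (integrable_continuous_mul (by fun_prop) hk).const_mul _

/-- The map x ↦ cos(πx) is injective on [0, 1], so by Weierstrass a continuous g is a uniform limit
of polynomials in cos(πx), all of which integrate to zero against k. Thus k is orthogonal to every
continuous function. -/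
theorem ae_eq_zero_of_integral_cos {k : ℝ → ℝ} (hk : Integrable k mu01)
    (h : ∀ m : ℕ, ∫ x in Ioo (0 : ℝ) 1, Real.cos (m * Real.pi * x) * k x = 0) :
    k =ᵐ[mu01] 0 := by
  have key : ∀ g : ℝ → ℝ, Continuous g → ∫ x in Ioo (0 : ℝ) 1, g x * k x = 0 := by
    intro g hg
    have hM : 0 ≤ ∫ x in Ioo (0 : ℝ) 1, |k x| := integral_nonneg fun x => abs_nonneg _
    set M := ∫ x in Ioo (0 : ℝ) 1, |k x| with hMdef
    refine abs_eq_zero.mp (le_antisymm (le_of_forall_pos_le_add fun ε hε => ?_) (abs_nonneg _))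
    obtain ⟨p, hp⟩ := exists_polynomial_near_of_continuousOn (-1) 1
      (fun y => g (Real.arccos y / Real.pi))
      (hg.comp (Real.continuous_arccos.div_const _)).continuousOn (ε / (M + 1)) (by positivity)
    have hi1 := integrable_continuous_mul hg hk
    have hi2 := integrable_continuous_mul
      (F := fun x => p.eval (Real.cos (Real.pi * x))) (by fun_prop) hk
    have e1 : ∫ x in Ioo (0 : ℝ) 1, g x * k x =
        ∫ x in Ioo (0 : ℝ) 1, (g x * k x - p.eval (Real.cos (Real.pi * x)) * k x) := by
      rw [integral_sub hi1 hi2, integral_polynomial_cos_mul_eq_zero hk h, sub_zero]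
    rw [zero_add, e1]
    have e2 := norm_integral_le_of_norm_le (μ := mu01)
      (f := fun x => g x * k x - p.eval (Real.cos (Real.pi * x)) * k x)
      (g := fun x => ε / (M + 1) * |k x|) (hk.abs.const_mul _) (by
        filter_upwards [ae_restrict_mem measurableSet_Ioo] with x hx
        have hx0 : 0 ≤ Real.pi * x := mul_nonneg Real.pi_pos.le hx.1.le
        have hx1 : Real.pi * x ≤ Real.pi := by nlinarith [hx.2, Real.pi_pos]
        have := hp (Real.cos (Real.pi * x)) ⟨Real.neg_one_le_cos _, Real.cos_le_one _⟩
        rw [Real.arccos_cos hx0 hx1, mul_div_cancel_left₀ _ Real.pi_ne_zero, abs_sub_comm] at this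
        rw [← sub_mul, norm_mul, Real.norm_eq_abs, Real.norm_eq_abs]
        exact mul_le_mul_of_nonneg_right this.le (abs_nonneg _))
    rw [integral_const_mul, ← hMdef, Real.norm_eq_abs] at e2
    refine e2.trans ?_
    rw [div_mul_eq_mul_div, div_le_iff₀ (by positivity)]
    nlinarith
  have hae := isOpen_Ioo.ae_eq_zero_of_integral_contDiff_smul_eq_zero (μ := (volume : Measure ℝ))
    (U := Ioo (0 : ℝ) 1) (f := k) (IntegrableOn.locallyIntegrableOn hk) (by
      intro φ h1 h2 h3
      rw [← setIntegral_eq_integral_of_forall_compl_eq_zero (s := Ioo (0 : ℝ) 1)]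
      · exact key φ h1.continuous
      · intro x hx
        rw [image_eq_zero_of_notMem_tsupport (fun hx' => hx (h3 hx')), zero_smul])
  rw [EventuallyEq, ae_restrict_iff' measurableSet_Ioo]
  exact hae

theorem integral_cos_int_mul_pi (j : ℤ) :
    ∫ x in (0 : ℝ)..1, Real.cos (j * Real.pi * x) = if j = 0 then 1 else 0 := by
  split_ifs with h
  · simp [h]
  · have hne : (j : ℝ) * Real.pi ≠ 0 := mul_ne_zero (by exact_mod_cast h) Real.pi_ne_zero
    rw [intervalIntegral.integral_comp_mul_left _ hne, integral_cos]
    simp [Real.sin_int_mul_pi]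

theorem integral_cos_add_cos (i j : ℤ) :
    ∫ x in (0 : ℝ)..1, (Real.cos (i * Real.pi * x) + Real.cos (j * Real.pi * x)) =
      (if i = 0 then 1 else 0) + if j = 0 then 1 else 0 := by
  rw [intervalIntegral.integral_add (Continuous.intervalIntegrable (by fun_prop) _ _)
    (Continuous.intervalIntegrable (by fun_prop) _ _), integral_cos_int_mul_pi,
    integral_cos_int_mul_pi]

theorem sqrt_two_mul_cos_mul (A B : ℝ) :
    √2 * Real.cos A * (√2 * Real.cos B) = Real.cos (A - B) + Real.cos (A + B) := by
  have := Real.mul_self_sqrt (show (0 : ℝ) ≤ 2 by norm_num)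
  rw [Real.cos_add, Real.cos_sub]
  linear_combination (Real.cos A * Real.cos B) * this

/-- The element of `L²(0,1)` given by `phi₁₁ n`. -/
def cosHalf (n : ℕ) : L2 := toL2 (phi₁₁ n) (continuous_phi₁₁ n)

/-- The element of `L²(0,1)` given by `phi₂₂ m`. -/
def cosInt (m : ℕ) : L2 := toL2 (phi₂₂ m) (continuous_phi₂₂ m)

theorem orthonormal_cosHalf : Orthonormal ℝ cosHalf := by
  rw [orthonormal_iff_ite]
  intro n n'
  rw [cosHalf, cosHalf, inner_toL2_toL2]
  have e : ∀ x, phi₁₁ n x * phi₁₁ n' x = Real.cos (((n : ℤ) - n' : ℤ) * Real.pi * x) +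
      Real.cos (((n : ℤ) + n' + 1 : ℤ) * Real.pi * x) := fun x => by
    rw [phi₁₁, phi₁₁, sqrt_two_mul_cos_mul]
    push_cast
    congr 2 <;> ring
  simp_rw [e]
  rw [integral_cos_add_cos, if_neg (show (n : ℤ) + n' + 1 ≠ 0 by omega), add_zero]
  simp only [sub_eq_zero, Nat.cast_inj]

theorem orthonormal_cosInt : Orthonormal ℝ cosInt := by
  rw [orthonormal_iff_ite]
  intro m m'
  rw [cosInt, cosInt, inner_toL2_toL2]
  have e0 : ∀ j : ℕ, j ≠ 0 → ∫ x in (0 : ℝ)..1, √2 * Real.cos (j * Real.pi * x) = 0 := by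
    intro j hj
    rw [intervalIntegral.integral_const_mul]
    have := integral_cos_int_mul_pi j
    rw [if_neg (by exact_mod_cast hj)] at this
    simp only [Int.cast_natCast] at this
    rw [this, mul_zero]
  by_cases hm : m = 0
  · by_cases hm' : m' = 0
    · simp [hm, hm', phi₂₂]
    · simp only [hm, hm', phi₂₂, if_true, if_false, one_mul, if_neg (Ne.symm hm')]
      exact e0 m' hm'
  · by_cases hm' : m' = 0
    · simp only [hm, hm', phi₂₂, if_true, if_false, mul_one]
      exact e0 m hm
    · have e : ∀ x, phi₂₂ m x * phi₂₂ m' x = Real.cos (((m : ℤ) - m' : ℤ) * Real.pi * x) +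
          Real.cos (((m : ℤ) + m' : ℤ) * Real.pi * x) := fun x => by
        rw [phi₂₂, phi₂₂, if_neg hm, if_neg hm', sqrt_two_mul_cos_mul]
        push_cast
        congr 2 <;> ring
      simp_rw [e]
      rw [integral_cos_add_cos, if_neg (show (m : ℤ) + m' ≠ 0 by omega), add_zero]
      simp only [sub_eq_zero, Nat.cast_inj]

theorem eq_zero_of_inner_cosInt {h : L2} (hh : ∀ m, inner ℝ (cosInt m) h = 0) : h = 0 := by
  refine Lp.ext (EventuallyEq.trans (ae_eq_zero_of_integral_cos (integrable_L2 h) fun m => ?_)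
    (Lp.coeFn_zero ℝ 2 mu01).symm)
  have hm := hh m
  rw [cosInt, inner_toL2] at hm
  by_cases h0 : m = 0
  · simpa [phi₂₂, h0] using hm
  · simp_rw [phi₂₂, if_neg h0, mul_assoc] at hm
    rw [integral_const_mul] at hm
    simpa [mul_assoc] using hm

/-- Multiplication by cos(πx/2) turns integer frequencies into half-integer ones, so h cos(πx/2) is
orthogonal to all cos(mπx) and vanishes. The weight is positive on (0, 1). For m = 0 the frequency
−1/2 is folded to 1/2 by evenness. -/
theorem eq_zero_of_inner_cosHalf {h : L2} (hh : ∀ n, inner ℝ (cosHalf n) h = 0) : h = 0 := by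
  have h1 : ∀ n : ℕ, ∫ x in Ioo (0 : ℝ) 1, Real.cos ((n + 1 / 2) * Real.pi * x) * h x = 0 := by
    intro n
    have hn := hh n
    rw [cosHalf, inner_toL2] at hn
    simp_rw [phi₁₁, mul_assoc] at hn
    rw [integral_const_mul] at hn
    simpa [mul_assoc] using hn
  have hk := integrable_continuous_mul (F := fun x => Real.cos (Real.pi / 2 * x)) (by fun_prop)
    (integrable_L2 h)
  have h2 := ae_eq_zero_of_integral_cos hk (by
    intro m
    have e : ∀ x : ℝ, Real.cos (m * Real.pi * x) * (Real.cos (Real.pi / 2 * x) * h x) =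
        1 / 2 * (Real.cos ((m + 1 / 2) * Real.pi * x) * h x +
          Real.cos ((m - 1 / 2) * Real.pi * x) * h x) := by
      intro x
      have e1 : ((m : ℝ) + 1 / 2) * Real.pi * x = m * Real.pi * x + Real.pi / 2 * x := by ring
      have e2 : ((m : ℝ) - 1 / 2) * Real.pi * x = m * Real.pi * x - Real.pi / 2 * x := by ring
      rw [e1, e2, Real.cos_add, Real.cos_sub]
      ring
    simp_rw [e]
    rw [integral_const_mul, integral_add
      (integrable_continuous_mul (by fun_prop) (integrable_L2 h))
      (integrable_continuous_mul (by fun_prop) (integrable_L2 h)), h1 m]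
    cases m with
    | zero =>
      have : ∫ x in Ioo (0 : ℝ) 1, Real.cos (((0 : ℕ) - 1 / 2) * Real.pi * x) * h x = 0 := by
        refine Eq.trans ?_ (h1 0)
        congr 1
        funext x
        rw [← Real.cos_neg]
        congr 2
        push_cast
        ring
      rw [this]
      simp
    | succ j =>
      have : ∫ x in Ioo (0 : ℝ) 1, Real.cos (((j + 1 : ℕ) - 1 / 2) * Real.pi * x) * h x = 0 := by
        refine Eq.trans ?_ (h1 j)
        congr 1
        funext x
        congr 3
        push_cast
        ring
      rw [this]
      simp)
  refine Lp.ext (EventuallyEq.trans ?_ (Lp.coeFn_zero ℝ 2 mu01).symm)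
  filter_upwards [h2, ae_restrict_mem measurableSet_Ioo] with x hx hx'
  have : 0 < Real.cos (Real.pi / 2 * x) := Real.cos_pos_of_mem_Ioo
    ⟨by nlinarith [hx'.1, Real.pi_pos], by nlinarith [hx'.2, Real.pi_pos]⟩
  exact (mul_eq_zero.mp hx).resolve_left this.ne'

theorem exists_hilbertBasis_of_total {ι E : Type*} [NormedAddCommGroup E]
    [InnerProductSpace ℝ E] [CompleteSpace E] {v : ι → E} (hv : Orthonormal ℝ v)
    (ht : ∀ x, (∀ i, inner ℝ (v i) x = 0) → x = 0) : ∃ e : HilbertBasis ι ℝ E, ⇑e = v := by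
  refine ⟨HilbertBasis.mkOfOrthogonalEqBot hv ?_, HilbertBasis.coe_mkOfOrthogonalEqBot hv _⟩
  rw [Submodule.eq_bot_iff]
  intro x hx
  exact ht x fun i => (Submodule.mem_orthogonal _ x).mp hx _ (Submodule.subset_span ⟨i, rfl⟩)

/-- The orthonormal family of all `(cosHalf n, 0)` and all `(0, cosInt m)`. -/
def cosFamily : ℕ ⊕ ℕ → H0 :=
  Sum.elim (fun n => WithLp.toLp 2 (cosHalf n, 0)) (fun m => WithLp.toLp 2 (0, cosInt m))

theorem exists_hilbertBasis_cosInt : ∃ e : HilbertBasis ℕ ℝ L2, ⇑e = cosInt :=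
  exists_hilbertBasis_of_total orthonormal_cosInt fun _ => eq_zero_of_inner_cosInt

theorem exists_hilbertBasis_cosFamily : ∃ e : HilbertBasis (ℕ ⊕ ℕ) ℝ H0, ⇑e = cosFamily := by
  refine exists_hilbertBasis_of_total ?_ fun u hu => ?_
  · rw [orthonormal_iff_ite]
    rintro (n | m) (n' | m')
    · simpa [cosFamily, WithLp.prod_inner_apply] using
        orthonormal_iff_ite.mp orthonormal_cosHalf n n'
    · simp [cosFamily, WithLp.prod_inner_apply]
    · simp [cosFamily, WithLp.prod_inner_apply]
    · simpa [cosFamily, WithLp.prod_inner_apply] using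
        orthonormal_iff_ite.mp orthonormal_cosInt m m'
  · have h1 : u.fst = 0 := eq_zero_of_inner_cosHalf fun n => by
      simpa [cosFamily, WithLp.prod_inner_apply] using hu (Sum.inl n)
    have h2 : u.snd = 0 := eq_zero_of_inner_cosInt fun m => by
      simpa [cosFamily, WithLp.prod_inner_apply] using hu (Sum.inr m)
    exact (WithLp.equiv 2 _).injective (Prod.ext h1 h2)

/-! ### The eigenvector equations -/

theorem toL2_zero : toL2 (fun _ => 0) continuous_const = 0 :=
  (toL2_eq continuous_const (Lp.coeFn_zero ℝ 2 mu01)).symm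

theorem mem_graph_of_hasDerivAt {a b s : ℝ} {f f' f'' g g' g'' : ℝ → ℝ} (hf : Continuous f)
    (hf' : Continuous f') (hf'' : Continuous f'') (hg : Continuous g) (hg' : Continuous g')
    (hg'' : Continuous g'') (df : ∀ x, HasDerivAt f (f' x) x)
    (df' : ∀ x, HasDerivAt f' (f'' x) x) (dg : ∀ x, HasDerivAt g (g' x) x)
    (dg' : ∀ x, HasDerivAt g' (g'' x) x) (h1 : f 1 = 0) (h2 : g' 0 = 0) (h3 : g' 1 = 0)
    (h4 : f' 0 = s * g 0) :
    (WithLp.toLp 2 (toL2 f hf, toL2 g hg),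
      WithLp.toLp 2 (toL2 f'' hf'' + a • toL2 f hf, toL2 g'' hg'' + b • toL2 g hg)) ∈
      (coupledOp a b s).graph := by
  have f1 := isWeakDeriv_toL2 hf hf' df
  have f2 := isWeakDeriv_toL2 hf' hf'' df'
  have g1 := isWeakDeriv_toL2 hg hg' dg
  have g2 := isWeakDeriv_toL2 hg' hg'' dg'
  rw [LinearPMap.mem_graph_iff]
  refine ⟨⟨WithLp.toLp 2 (toL2 f hf, toL2 g hg), ⟨_, _, f1, f2⟩, ⟨_, _, g1, g2⟩, ?_, ?_, ?_,
    g 0, hasTrace_toL2 hg 0, ?_⟩, rfl, ?_⟩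
  · rw [← h1]; exact hasTrace_toL2 hf 1
  · change HasTrace (weakDeriv (toL2 g hg)) 0 0
    rw [g1.eq]
    simpa only [h2] using hasTrace_toL2 hg' 0
  · change HasTrace (weakDeriv (toL2 g hg)) 1 0
    rw [g1.eq]
    simpa only [h3] using hasTrace_toL2 hg' 1
  · rw [← h4]; change HasTrace (weakDeriv (toL2 f hf)) _ _; rw [f1.eq]; exact hasTrace_toL2 hf' 0
  · change WithLp.toLp 2 (weakDeriv (weakDeriv (toL2 f hf)) + a • toL2 f hf,
      weakDeriv (weakDeriv (toL2 g hg)) + b • toL2 g hg) = _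
    rw [f1.eq, f2.eq, g1.eq, g2.eq]

theorem hasDerivAt_mul_cos (c w x : ℝ) :
    HasDerivAt (fun x => c * Real.cos (w * x)) (-(c * w) * Real.sin (w * x)) x := by
  exact ((((hasDerivAt_id x).const_mul w).cos).const_mul c).congr_deriv (by
    simp only [id, mul_one]
    ring)

theorem hasDerivAt_mul_sin (c w x : ℝ) :
    HasDerivAt (fun x => c * Real.sin (w * x)) (c * w * Real.cos (w * x)) x := by
  exact ((((hasDerivAt_id x).const_mul w).sin).const_mul c).congr_deriv (by
    simp only [id, mul_one]
    ring)

theorem phi₂₂_eq (m : ℕ) : phi₂₂ m = fun x => muCoef m * Real.cos (m * Real.pi * x) := by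
  funext x
  rw [muCoef, phi₂₂, phi₂₂]
  split_ifs with h <;> simp [h]

theorem cos_half_pi (n : ℕ) : Real.cos ((n + 1 / 2) * Real.pi) = 0 :=
  Real.cos_eq_zero_iff.mpr ⟨n, by push_cast; ring⟩

theorem Phi₁_mem_graph (a b s : ℝ) (n : ℕ) :
    (Phi₁ n, eig₁ a n • Phi₁ n) ∈ (coupledOp a b s).graph := by
  have h := mem_graph_of_hasDerivAt (a := a) (b := b) (s := s) (f := phi₁₁ n)
    (f' := fun x => -(√2 * ((n + 1 / 2) * Real.pi)) * Real.sin ((n + 1 / 2) * Real.pi * x))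
    (f'' := fun x => -((n + 1 / 2) * Real.pi) ^ 2 * phi₁₁ n x)
    (g := fun _ => 0) (g' := fun _ => 0) (g'' := fun _ => 0)
    (continuous_phi₁₁ n) (by fun_prop) (continuous_const.mul (continuous_phi₁₁ n))
    continuous_const continuous_const continuous_const
    (fun x => hasDerivAt_mul_cos _ _ x) (fun x => (hasDerivAt_mul_sin _ _ x).congr_deriv (by
      rw [phi₁₁]
      ring)) (fun x => hasDerivAt_const x 0) (fun x => hasDerivAt_const x 0)
    (by rw [phi₁₁, mul_one, cos_half_pi, mul_zero]) rfl rfl (by simp)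
  rw [toL2_zero, ← toL2_smul _ (continuous_phi₁₁ n), ← add_smul, smul_zero, add_zero] at h
  have e : eig₁ a n = -(((n : ℝ) + 1 / 2) * Real.pi) ^ 2 + a := by
    rw [eig₁]
    ring
  rwa [Phi₁, ← WithLp.toLp_smul, Prod.smul_mk, smul_zero, e]

open Classical in
/-- The coupling `(A - λ) φ_{2,m}` as a function. -/
def resonanceFun (a b s : ℝ) (m : ℕ) (x : ℝ) : ℝ :=
  if h : m ∈ Delta₂ a b then -(√2 * s * muCoef m) * phi₁₁ h.choose x else 0

theorem continuous_resonanceFun (a b s : ℝ) (m : ℕ) : Continuous (resonanceFun a b s m) := by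
  unfold resonanceFun
  split_ifs
  · exact continuous_const.mul (continuous_phi₁₁ _)
  · exact continuous_const

/-- The first component of `(A - λ) φ_{2,m}`. -/
def resonance (a b s : ℝ) (m : ℕ) : L2 :=
  toL2 (resonanceFun a b s m) (continuous_resonanceFun a b s m)

theorem resonance_of_mem {a b : ℝ} (s : ℝ) {m : ℕ} (h : m ∈ Delta₂ a b) :
    resonance a b s m = -(√2 * s * muCoef m) • cosHalf h.choose := by
  rw [resonance, cosHalf, toL2_smul]
  exact toL2_congr _ _ fun x => by rw [resonanceFun, dif_pos h]

theorem resonance_of_notMem {a b : ℝ} (s : ℝ) {m : ℕ} (h : m ∉ Delta₂ a b) :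
    resonance a b s m = 0 := by
  rw [resonance, ← toL2_zero]
  exact toL2_congr _ _ fun x => by rw [resonanceFun, dif_neg h]

theorem eig₂_sub_of_mem_Delta {a b : ℝ} {k m : ℕ} (h : (k, m) ∈ Delta a b) :
    eig₂ b m - a = -(((k : ℝ) + 1 / 2) * Real.pi) ^ 2 := by
  have h' : 4 * (b - a) = (4 * (m : ℝ) ^ 2 - (2 * (k : ℝ) + 1) ^ 2) * Real.pi ^ 2 := h
  rw [eig₂]
  linarith

/-- Since cosh r = cos(ir), a zero forces ir to be an odd multiple of π/2, which is the resonance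
condition. Hence the denominator in φ¹_{2,m} is nonzero off resonance. -/
theorem mem_Delta₂_of_cosh_eq_zero {a b : ℝ} {m : ℕ} {r : ℂ}
    (hr : r ^ 2 = ((eig₂ b m - a : ℝ) : ℂ)) (h : Complex.cosh r = 0) : m ∈ Delta₂ a b := by
  rw [← Complex.cos_mul_I, Complex.cos_eq_zero_iff] at h
  obtain ⟨k, hk⟩ := h
  have e1 : (((eig₂ b m - a : ℝ)) : ℂ) = ((-((2 * k + 1) * Real.pi / 2) ^ 2 : ℝ) : ℂ) := by
    rw [← hr]
    push_cast
    rw [← hk, mul_pow, Complex.I_sq]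
    ring
  have e2 := Complex.ofReal_injective e1
  -- For k < 0, the natural number n = −k − 1 satisfies 2n + 1 = −(2k + 1).
  obtain ⟨n, hn⟩ : ∃ n : ℕ, (2 * (k : ℝ) + 1) ^ 2 = (2 * (n : ℝ) + 1) ^ 2 := by
    rcases le_or_gt 0 k with hk0 | hk0
    · lift k to ℕ using hk0
      exact ⟨k, by simp⟩
    · obtain ⟨n, hn⟩ := Int.eq_ofNat_of_zero_le (show 0 ≤ -k - 1 by omega)
      refine ⟨n, ?_⟩
      have : (k : ℝ) = -n - 1 := by
        have h2 : k = -(n : ℤ) - 1 := by omega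
        rw [h2]; push_cast; ring
      rw [this]
      ring
  refine ⟨n, ?_⟩
  change 4 * (b - a) = (4 * (m : ℝ) ^ 2 - (2 * (n : ℝ) + 1) ^ 2) * Real.pi ^ 2
  rw [← hn]
  rw [eig₂] at e2
  linarith

/-- F is the derivative. At resonance, the unforced problem with f(1) = 0 admits only f'(0) = 0, so
the factor 1 − x is introduced; differentiating it produces the forcing −2sμ cos(wx), a multiple of
φ_{1,k}. -/
theorem exists_deriv_phi₂₁ (a b s : ℝ) (m : ℕ) : ∃ F : ℝ → ℝ, Continuous F ∧
    (∀ x, HasDerivAt (phi₂₁ a b s m) (F x) x) ∧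
    (∀ x, HasDerivAt F ((eig₂ b m - a) * phi₂₁ a b s m x + resonanceFun a b s m x) x) ∧
    phi₂₁ a b s m 1 = 0 ∧ F 0 = s * muCoef m := by
  by_cases h : m ∈ Delta₂ a b
  · have hk := eig₂_sub_of_mem_Delta h.choose_spec
    set w : ℝ := ((h.choose : ℕ) + 1 / 2 : ℝ) * Real.pi with hw
    have hw0 : w ≠ 0 := by positivity
    set c : ℝ := s * muCoef m / w with hc
    have hcw : c * w = s * muCoef m := div_mul_cancel₀ _ hw0
    have e : phi₂₁ a b s m = fun x => (1 - x) * (c * Real.sin (w * x)) := by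
      funext x
      rw [phi₂₁, dif_pos h]
      ring
    have hl : ∀ x : ℝ, HasDerivAt (fun x : ℝ => 1 - x) (-1) x := fun x =>
      (hasDerivAt_id x).const_sub 1
    refine ⟨fun x => -1 * (c * Real.sin (w * x)) + (1 - x) * (c * w * Real.cos (w * x)),
      by fun_prop, fun x => ?_, fun x => ?_, ?_, ?_⟩
    · rw [e]
      exact (hl x).mul (hasDerivAt_mul_sin c w x)
    · refine (((hasDerivAt_mul_sin c w x).const_mul (-1)).add
        ((hl x).mul (hasDerivAt_mul_cos (c * w) w x))).congr_deriv ?_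
      rw [e, hk, resonanceFun, dif_pos h, phi₁₁, ← hw]
      have := Real.mul_self_sqrt (show (0 : ℝ) ≤ 2 by norm_num)
      linear_combination (s * muCoef m * Real.cos (w * x)) * this -
        2 * Real.cos (w * x) * hcw
    · simp [e]
    · simp [hcw]
  by_cases h0 : b - a = (m : ℝ) ^ 2 * Real.pi ^ 2
  · have e : phi₂₁ a b s m = fun x => s * muCoef m * (-1 + x) := by
      funext x
      rw [phi₂₁, dif_neg h, if_pos h0]
    refine ⟨fun _ => s * muCoef m, continuous_const, fun x => ?_, fun x => ?_, ?_, rfl⟩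
    · rw [e]
      simpa using ((hasDerivAt_id x).const_add (-1)).const_mul (s * muCoef m)
    · refine (hasDerivAt_const x (s * muCoef m)).congr_deriv ?_
      rw [resonanceFun, dif_neg h, eig₂]
      linear_combination -phi₂₁ a b s m x * h0
    · simp [e]
  · have hr2 := rootR_sq a b m
    set r := rootR a b m with hr
    have hr0 : r ≠ 0 := by
      intro hr0
      rw [hr0, zero_pow two_ne_zero] at hr2
      have : eig₂ b m - a = 0 := (Complex.ofReal_eq_zero.mp hr2.symm)
      rw [eig₂] at this
      exact h0 (by linarith)
    have hch : Complex.cosh r ≠ 0 := fun hch => h (mem_Delta₂_of_cosh_eq_zero hr2 hch)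
    set C : ℂ := -((s * muCoef m : ℝ) : ℂ) / (r * Complex.cosh r) with hC
    have e : phi₂₁ a b s m = fun x : ℝ => (C * Complex.sinh (r * (1 - (x : ℂ)))).re := by
      funext x
      rw [phi₂₁, dif_neg h, if_neg h0]
    have hl : ∀ x : ℝ, HasDerivAt (fun x : ℝ => r * (1 - (x : ℂ))) (-r) x := fun x => by
      simpa using (((hasDerivAt_id x).ofReal_comp).const_sub 1).const_mul r
    have hre : ∀ {G : ℝ → ℂ} {G' : ℂ} {x : ℝ}, HasDerivAt G G' x →
        HasDerivAt (fun x => (G x).re) G'.re x := fun hG =>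
      Complex.reCLM.hasFDerivAt.comp_hasDerivAt _ hG
    refine ⟨fun x : ℝ => (C * (Complex.cosh (r * (1 - (x : ℂ))) * -r)).re, ?_, fun x => ?_,
      fun x => ?_, ?_, ?_⟩
    · exact Complex.continuous_re.comp (continuous_const.mul
        ((Complex.continuous_cosh.comp (by fun_prop)).mul continuous_const))
    · rw [e]
      exact hre (((Complex.hasDerivAt_sinh _).comp x (hl x)).const_mul C)
    · refine (hre ((((Complex.hasDerivAt_cosh _).comp x (hl x)).mul_const (-r)).const_mul
        C)).congr_deriv ?_
      rw [e, resonanceFun, dif_neg h, add_zero, ← Complex.re_ofReal_mul, ← hr2]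
      congr 1
      ring
    · simp [e]
    · have : C * (Complex.cosh (r * (1 - ((0 : ℝ) : ℂ))) * -r) = ((s * muCoef m : ℝ) : ℂ) := by
        rw [hC, Complex.ofReal_zero, sub_zero, mul_one]
        field_simp
      change (C * (Complex.cosh (r * (1 - ((0 : ℝ) : ℂ))) * -r)).re = _
      rw [this, Complex.ofReal_re]

/-- The element of `L²(0,1)` given by `phi₂₁`. -/
def phi₂₁L2 (a b s : ℝ) (m : ℕ) : L2 := toL2 (phi₂₁ a b s m) (continuous_phi₂₁ a b s m)

theorem Phi₂_mem_graph (a b s : ℝ) (m : ℕ) :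
    (Phi₂ a b s m, WithLp.toLp 2 (eig₂ b m • phi₂₁L2 a b s m + resonance a b s m,
      eig₂ b m • cosInt m)) ∈ (coupledOp a b s).graph := by
  obtain ⟨F, hF, d1, d2, h1, h2⟩ := exists_deriv_phi₂₁ a b s m
  have h := mem_graph_of_hasDerivAt (a := a) (b := b) (s := s)
    (f'' := fun x => (eig₂ b m - a) * phi₂₁ a b s m x + resonanceFun a b s m x)
    (g := phi₂₂ m)
    (g' := fun x => -(muCoef m * (m * Real.pi)) * Real.sin (m * Real.pi * x))
    (g'' := fun x => -(m * Real.pi) ^ 2 * phi₂₂ m x)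
    (continuous_phi₂₁ a b s m) hF
    ((continuous_const.mul (continuous_phi₂₁ a b s m)).add (continuous_resonanceFun a b s m))
    (continuous_phi₂₂ m) (by fun_prop) (continuous_const.mul (continuous_phi₂₂ m)) d1 d2
    (fun x => by rw [phi₂₂_eq]; exact hasDerivAt_mul_cos _ _ x)
    (fun x => (hasDerivAt_mul_sin _ _ x).congr_deriv (by
      rw [phi₂₂_eq]
      ring)) h1 (by simp) (by simp [Real.sin_nat_mul_pi]) h2
  have e1 : eig₂ b m • phi₂₁L2 a b s m + resonance a b s m =
      toL2 (fun x => (eig₂ b m - a) * phi₂₁ a b s m x + resonanceFun a b s m x)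
        ((continuous_const.mul (continuous_phi₂₁ a b s m)).add
          (continuous_resonanceFun a b s m)) + a • phi₂₁L2 a b s m := by
    have : toL2 (fun x => (eig₂ b m - a) * phi₂₁ a b s m x + resonanceFun a b s m x)
        ((continuous_const.mul (continuous_phi₂₁ a b s m)).add
          (continuous_resonanceFun a b s m)) =
        (eig₂ b m - a) • phi₂₁L2 a b s m + resonance a b s m := by
      rw [phi₂₁L2, toL2_smul, resonance, toL2_add]
    rw [this, sub_smul]
    abel
  have e2 : eig₂ b m • cosInt m = toL2 (fun x => -(m * Real.pi) ^ 2 * phi₂₂ m x)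
      (continuous_const.mul (continuous_phi₂₂ m)) + b • cosInt m := by
    rw [← toL2_smul _ (continuous_phi₂₂ m), ← cosInt, ← add_smul, eig₂]
    congr 1
    ring
  rw [e1, e2]
  exact h

/-! ### Numbers to the right of the spectrum -/

theorem inner_deriv₂_volterra {ψ ψ' ψ'' : ℝ → ℝ} (hψ : ∀ x, HasDerivAt ψ (ψ' x) x)
    (hψ' : ∀ x, HasDerivAt ψ' (ψ'' x) x) (hc : Continuous ψ) (hc' : Continuous ψ')
    (hc'' : Continuous ψ'') (d e : ℝ) (h : L2) :
    inner ℝ (toL2 ψ'' hc'') (d • one + volterra (e • one + volterra h)) =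
      (d + inner ℝ one (e • one + volterra h)) * ψ' 1 - d * ψ' 0 -
        ((e + inner ℝ one h) * ψ 1 - e * ψ 0 - inner ℝ (toL2 ψ hc) h) := by
  rw [inner_deriv_const_add_volterra hψ' hc' hc'', inner_deriv_const_add_volterra hψ hc hc']

/-- The cascade is solved from below. Green's formula against the Neumann cosines gives (l − b +
m²π²)⟨cos, g⟩ = 0 with a positive factor, so g = 0 and its trace c vanishes. Then f satisfies
homogeneous conditions, and the half-integer cosines finish in the same way. -/
theorem eq_zero_of_mem_graph {a b s l : ℝ} (ha : a < l) (hb : b < l) {u : H0}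
    (hu : (u, l • u) ∈ (coupledOp a b s).graph) : u = 0 := by
  obtain ⟨c, d, h1, h2, h3, h4⟩ := mem_graph_coupledOp_iff.mp hu
  have eq : (l • u).snd - b • u.snd = (l - b) • u.snd := (sub_smul _ _ _).symm
  have ep : (l • u).fst - a • u.fst = (l - a) • u.fst := (sub_smul _ _ _).symm
  rw [eq] at h1 h2
  rw [ep] at h3 h4
  have hg : u.snd = 0 := eq_zero_of_inner_cosInt fun m => by
    have h2' : u.snd = c • one + volterra ((0 : ℝ) • one + volterra ((l - b) • u.snd)) := by
      rw [zero_smul, zero_add]; exact h2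
    have key := inner_deriv₂_volterra (ψ := phi₂₂ m)
      (ψ' := fun x => -(muCoef m * (m * Real.pi)) * Real.sin (m * Real.pi * x))
      (ψ'' := fun x => -(m * Real.pi) ^ 2 * phi₂₂ m x)
      (fun x => by rw [phi₂₂_eq]; exact hasDerivAt_mul_cos _ _ x)
      (fun x => (hasDerivAt_mul_sin _ _ x).congr_deriv (by
        rw [phi₂₂_eq]
        ring)) (continuous_phi₂₂ m) (by fun_prop) (continuous_const.mul (continuous_phi₂₂ m))
      c 0 ((l - b) • u.snd)
    rw [← h2', h1, ← toL2_smul _ (continuous_phi₂₂ m), inner_smul_left, inner_smul_right] at key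
    simp only [RCLike.conj_to_real, mul_one, Real.sin_nat_mul_pi, mul_zero, Real.sin_zero,
      zero_mul, add_zero, sub_zero, zero_sub, neg_neg] at key
    have e : (l - b + (m * Real.pi) ^ 2) * inner ℝ (cosInt m) u.snd = 0 := by
      rw [cosInt]
      linarith
    refine (mul_eq_zero.mp e).resolve_left ?_
    nlinarith [sq_nonneg (m * Real.pi)]
  have hc : c = 0 := by
    rw [hg, smul_zero, map_zero, map_zero, add_zero] at h2
    have := congrArg (fun v => (inner ℝ one v : ℝ)) h2
    simp only [inner_zero_right, inner_smul_right, inner_one_one, mul_one] at this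
    exact this.symm
  subst hc
  have hf : u.fst = 0 := eq_zero_of_inner_cosHalf fun n => by
    have key := inner_deriv₂_volterra (ψ := phi₁₁ n)
      (ψ' := fun x => -(√2 * ((n + 1 / 2) * Real.pi)) * Real.sin ((n + 1 / 2) * Real.pi * x))
      (ψ'' := fun x => -((n + 1 / 2) * Real.pi) ^ 2 * phi₁₁ n x)
      (fun x => hasDerivAt_mul_cos _ _ x) (fun x => (hasDerivAt_mul_sin _ _ x).congr_deriv (by
        rw [phi₁₁]
        ring)) (continuous_phi₁₁ n) (by fun_prop) (continuous_const.mul (continuous_phi₁₁ n))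
      d (s * 0) ((l - a) • u.fst)
    have h5 : phi₁₁ n 1 = 0 := by rw [phi₁₁, mul_one, cos_half_pi, mul_zero]
    rw [← h4, h3, h5, ← toL2_smul _ (continuous_phi₁₁ n), inner_smul_left] at key
    simp only [inner_smul_right, RCLike.conj_to_real, mul_zero, Real.sin_zero,
      zero_mul, sub_zero, zero_sub, neg_neg] at key
    have e : (l - a + ((n + 1 / 2) * Real.pi) ^ 2) * inner ℝ (cosHalf n) u.fst = 0 := by
      rw [cosHalf]
      linarith
    refine (mul_eq_zero.mp e).resolve_left ?_
    nlinarith [sq_nonneg (((n : ℝ) + 1 / 2) * Real.pi)]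
  exact (WithLp.equiv 2 _).injective (Prod.ext hf hg)

/-! ### Decay of the first components -/

theorem abs_muCoef_le (m : ℕ) : |muCoef m| ≤ 2 := by
  rw [muCoef, phi₂₂]
  split_ifs
  · norm_num
  · rw [mul_zero, Real.cos_zero, mul_one, abs_of_nonneg (Real.sqrt_nonneg _), Real.sqrt_le_left]
    · norm_num
    · norm_num

/-- From (ρ − mπ)(ρ + mπ) = −(b − a) and |b − a| ≤ m, the number ρ is within 1 of mπ. Hence |cos ρ|
= |cos(ρ − mπ)| ≥ 1 − 1/2, which keeps the denominators of φ¹_{2,m} away from zero. -/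
theorem exists_sqrt_estimate {a b : ℝ} {m : ℕ} (hm : |b - a| + 1 ≤ m) :
    ∃ ρ : ℝ, ρ ^ 2 = -(eig₂ b m - a) ∧ (m : ℝ) ≤ ρ ∧ 1 / 2 ≤ |Real.cos ρ| := by
  have h1 : (1 : ℝ) ≤ m := by linarith [abs_nonneg (b - a)]
  have hpi := Real.pi_gt_three
  have hle := abs_le.mp (show |b - a| ≤ m by linarith)
  have hm2 : (m : ℝ) ≤ (m : ℝ) ^ 2 := by nlinarith
  have hpi2 : 9 * (m : ℝ) ^ 2 ≤ (m : ℝ) ^ 2 * Real.pi ^ 2 := by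
    have : 9 ≤ Real.pi ^ 2 := by nlinarith
    nlinarith [sq_nonneg (m : ℝ)]
  have hnn : 0 ≤ -(eig₂ b m - a) := by
    rw [eig₂]
    nlinarith
  have hsq := Real.sq_sqrt hnn
  set ρ := √(-(eig₂ b m - a)) with hρ
  have hρm : (m : ℝ) ≤ ρ := by
    refine Real.le_sqrt_of_sq_le ?_
    rw [eig₂]
    nlinarith
  refine ⟨ρ, hsq, hρm, ?_⟩
  have hprod : (ρ - m * Real.pi) * (ρ + m * Real.pi) = -(b - a) := by
    rw [eig₂] at hsq
    linear_combination hsq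
  have hsmall : |ρ - m * Real.pi| ≤ 1 := by
    have hpos : 0 < ρ + m * Real.pi := by positivity
    have h2 : |ρ - m * Real.pi| * (ρ + m * Real.pi) = |b - a| := by
      rw [← abs_neg (b - a), ← hprod, abs_mul, abs_of_pos hpos]
    by_contra hcon
    push Not at hcon
    nlinarith [mul_pos (show (0 : ℝ) < m by linarith) Real.pi_pos]
  have hcos := Real.cos_sub_nat_mul_pi ρ m
  have hlow := Real.one_sub_sq_div_two_le_cos (x := ρ - m * Real.pi)
  have hsq1 : (ρ - m * Real.pi) ^ 2 ≤ 1 := (sq_le_one_iff_abs_le_one _).mpr hsmall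
  have habs : |Real.cos ρ| = |Real.cos (ρ - m * Real.pi)| := by
    rw [hcos, abs_mul, abs_pow, abs_neg, abs_one, one_pow, one_mul]
  rw [habs]
  exact (by linarith : (1 : ℝ) / 2 ≤ Real.cos (ρ - m * Real.pi)).trans (le_abs_self _)

/-- A resonance would give ρ = (k + 1/2)π, where the cosine vanishes. So only finitely many m are
resonant. -/
theorem notMem_Delta₂ {a b : ℝ} {m : ℕ} (hm : |b - a| + 1 ≤ m) : m ∉ Delta₂ a b := by
  rintro ⟨k, hk⟩
  obtain ⟨ρ, h1, h2, h3⟩ := exists_sqrt_estimate hm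
  rw [eig₂_sub_of_mem_Delta hk, neg_neg] at h1
  have hρ : ρ = (k + 1 / 2) * Real.pi :=
    (pow_left_inj₀ ((Nat.cast_nonneg m).trans h2) (by positivity) two_ne_zero).mp h1
  rw [hρ, cos_half_pi, abs_zero] at h3
  norm_num at h3

/-- For large m the square root is r = iρ, and the function is −sμ sin(ρ(1 − x))/(ρ cos ρ). The
constant 4 comes from |μ| ≤ 2 and |cos ρ| ≥ 1/2, the decay from ρ ≥ m. -/
theorem abs_phi₂₁_le {a b : ℝ} (s : ℝ) {m : ℕ} (hm : |b - a| + 1 ≤ m) (x : ℝ) :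
    |phi₂₁ a b s m x| ≤ 4 * |s| / m := by
  obtain ⟨ρ, h1, h2, h3⟩ := exists_sqrt_estimate hm
  have hm0 : (0 : ℝ) < m := by linarith [abs_nonneg (b - a)]
  have hρ : 0 < ρ := hm0.trans_le h2
  have hne : b - a ≠ (m : ℝ) ^ 2 * Real.pi ^ 2 := by
    intro h
    rw [eig₂] at h1
    nlinarith
  have hr : ((ρ : ℂ) * Complex.I) ^ 2 = ((eig₂ b m - a : ℝ) : ℂ) := by
    rw [mul_pow, Complex.I_sq, ← Complex.ofReal_pow, h1]
    push_cast
    ring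
  have e := ofReal_phi₂₁ (s := s) (notMem_Delta₂ hm) hne hr x
  have hc0 : Real.cos ρ ≠ 0 := fun h => by rw [h, abs_zero] at h3; norm_num at h3
  have e2 : phi₂₁ a b s m x =
      -(s * muCoef m * Real.sin (ρ * (1 - x))) / (ρ * Real.cos ρ) := by
    refine Complex.ofReal_injective ?_
    rw [e]
    have e3 : (ρ : ℂ) * Complex.I * (1 - (x : ℂ)) = ((ρ * (1 - x) : ℝ) : ℂ) * Complex.I := by
      push_cast
      ring
    have hc0' : Complex.cos (ρ : ℂ) ≠ 0 := by rw [← Complex.ofReal_cos]; exact_mod_cast hc0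
    have hρ' : (ρ : ℂ) ≠ 0 := by exact_mod_cast hρ.ne'
    rw [e3, Complex.cosh_mul_I, Complex.sinh_mul_I]
    push_cast
    field_simp [Complex.I_ne_zero]
  rw [e2, abs_div, abs_neg, abs_mul, abs_mul, abs_mul, abs_of_pos hρ,
    div_le_div_iff₀ (by positivity) hm0]
  have hs := Real.abs_sin_le_one (ρ * (1 - x))
  have hmu := abs_muCoef_le m
  calc |s| * |muCoef m| * |Real.sin (ρ * (1 - x))| * m ≤ |s| * 2 * 1 * m := by gcongr
    _ = 4 * |s| * (m * (1 / 2)) := by ring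
    _ ≤ 4 * |s| * (ρ * |Real.cos ρ|) := by gcongr

theorem summable_norm_phi₂₁L2_sq (a b s : ℝ) :
    Summable fun m => ‖phi₂₁L2 a b s m‖ ^ 2 := by
  have hsum : Summable fun m : ℕ => (4 * |s|) ^ 2 * (1 / (m : ℝ) ^ 2) :=
    (Real.summable_one_div_nat_pow.mpr one_lt_two).mul_left _
  refine hsum.of_norm_bounded_eventually_nat ?_
  filter_upwards [eventually_ge_atTop ⌈|b - a| + 1⌉₊] with m hm
  have hm' : |b - a| + 1 ≤ m := Nat.ceil_le.mp hm
  have h := Lp.norm_le_of_ae_bound (f := phi₂₁L2 a b s m) (C := 4 * |s| / m) (by positivity) (by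
    filter_upwards [coeFn_toL2 (continuous_phi₂₁ a b s m)] with x hx
    rw [phi₂₁L2, hx]
    exact abs_phi₂₁_le s hm' x)
  simp only [measureUnivNNReal, measure_univ, ENNReal.toNNReal_one, NNReal.coe_one,
    Real.one_rpow, one_mul] at h
  rw [norm_pow, norm_norm, mul_one_div, ← div_pow]
  exact pow_le_pow_left₀ (norm_nonneg _) h 2

theorem summable_norm_resonance_sq (a b s : ℝ) :
    Summable fun m => ‖resonance a b s m‖ ^ 2 := by
  refine summable_of_ne_finset_zero (s := Finset.range ⌈|b - a| + 1⌉₊) fun m hm => ?_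
  rw [Finset.mem_range, not_lt] at hm
  rw [resonance_of_notMem s (notMem_Delta₂ (Nat.ceil_le.mp hm)), norm_zero, zero_pow two_ne_zero]

/-! ### The Riesz basis -/

/-- The operator `(f, g) ↦ (K g, 0)`. -/
def upper (K : L2 →L[ℝ] L2) : H0 →L[ℝ] H0 :=
  ((WithLp.prodContinuousLinearEquiv 2 ℝ L2 L2).symm : L2 × L2 →L[ℝ] H0).comp
    (((ContinuousLinearMap.inl ℝ L2 L2).comp (K.comp (ContinuousLinearMap.snd ℝ L2 L2))).comp
      (WithLp.prodContinuousLinearEquiv 2 ℝ L2 L2 : H0 →L[ℝ] L2 × L2))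

theorem upper_apply (K : L2 →L[ℝ] L2) (u : H0) : upper K u = WithLp.toLp 2 (K u.snd, 0) := rfl

theorem upper_upper (K K' : L2 →L[ℝ] L2) (u : H0) : upper K (upper K' u) = 0 := by
  change WithLp.toLp 2 (K 0, 0) = 0
  rw [map_zero]
  rfl

/-- The isomorphism `(f, g) ↦ (f + K g, g)`. -/
def shear (K : L2 →L[ℝ] L2) : H0 ≃L[ℝ] H0 :=
  ContinuousLinearEquiv.equivOfInverse (ContinuousLinearMap.id ℝ H0 + upper K)
    (ContinuousLinearMap.id ℝ H0 - upper K)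
    (fun u => by simp [upper_upper]) (fun u => by simp [upper_upper])

theorem shear_apply (K : L2 →L[ℝ] L2) (u : H0) : shear K u = u + upper K u := rfl

/-- Jordan chains have length at most two: A − λ maps T e_i to T N e_i, which is zero or an
eigenvector for the same λ because N² = 0. -/
theorem isGeneralizedEigenvector_of_rieszBasis {ι E : Type*} [NormedAddCommGroup E]
    [InnerProductSpace ℝ E] (e : HilbertBasis ι ℝ E) {lam : ι → ℝ} {N : E →L[ℝ] E}
    (hN : ∀ i, N (e i) = 0 ∨ ∃ (j : ι) (c : ℝ), lam j = lam i ∧ N (e i) = c • e j)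
    (hNN : ∀ x, N (N x) = 0) (T : E ≃L[ℝ] E) {A : E →ₗ.[ℝ] E}
    (hT : ∀ i, (T (e i), T (lam i • e i + N (e i))) ∈ A.graph) (i : ι) :
    IsGeneralizedEigenvector A (lam i) (T (e i)) := by
  constructor
  · rw [ne_eq, T.map_eq_zero_iff]
    exact e.orthonormal.ne_zero i
  · have key : ∀ k u w, (u, w) ∈ A.graph → PowKills A (lam i) k (w - lam i • u) →
        PowKills A (lam i) (k + 1) u := by
      intro k u w huw hk
      obtain ⟨⟨y, hy⟩, rfl, rfl⟩ := A.mem_graph_iff.mp huw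
      exact ⟨hy, hk⟩
    refine ⟨2, key 1 _ _ (hT i) ?_⟩
    rw [map_add, map_smul, add_sub_cancel_left]
    have hmem : (T (N (e i)), lam i • T (N (e i))) ∈ A.graph := by
      rcases hN i with h | ⟨j, c, hj, h⟩
      · rw [h, map_zero, smul_zero]
        exact A.graph.zero_mem
      -- Only the multiple by c is known to vanish; N (e j) itself need not if c = 0.
      · have h0 : c • N (e j) = 0 := by rw [← map_smul, ← h, hNN]
        have e1 : c • T (e j) = T (N (e i)) := by rw [h, map_smul]
        have e2 : c • T (lam j • e j + N (e j)) = lam i • T (N (e i)) := by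
          rw [map_add, map_smul, smul_add, ← map_smul T c (N (e j)), h0, map_zero, add_zero, hj,
            smul_comm, e1]
        rw [← e2, ← e1]
        exact A.graph.smul_mem c (hT j)
    exact key 0 _ _ hmem (sub_self _)

end HeatCascade

end


/-! ### Assembly: shear, nilpotent part, generation -/

theorem mainTheorem4 (a b s : ℝ) (hs : s ≠ 0) :
    (∀ i : ℕ ⊕ ℕ, HeatCascade.IsGeneralizedEigenvector (HeatCascade.coupledOp a b s)
      (HeatCascade.eig a b i) (HeatCascade.Phi a b s i)) ∧
    HeatCascade.IsRieszBasis (HeatCascade.Phi a b s) ∧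
    HeatCascade.GeneratesC0Semigroup (HeatCascade.coupledOp a b s) := by
  open HeatCascade in
  obtain ⟨c, hc⟩ := exists_hilbertBasis_cosInt
  obtain ⟨e, he⟩ := exists_hilbertBasis_cosFamily
  -- K carries the first components of φ_{2,m}; N below carries the Jordan couplings, of which only
  -- finitely many are nonzero.
  obtain ⟨K, hK⟩ := exists_clm_of_summable c (summable_norm_phi₂₁L2_sq a b s)
  obtain ⟨N, hN⟩ := exists_clm_of_summable c (summable_norm_resonance_sq a b s)
  rw [hc] at hK hN
  have hinl : ∀ (M : L2 →L[ℝ] L2) n, upper M (e (Sum.inl n)) = 0 := fun M n => by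
    rw [he, upper_apply]
    change WithLp.toLp 2 (M 0, 0) = 0
    rw [map_zero]
    rfl
  have hinr : ∀ (M : L2 →L[ℝ] L2) m,
      upper M (e (Sum.inr m)) = WithLp.toLp 2 (M (cosInt m), 0) := fun M m => by
    rw [he]
    rfl
  have hPhi : ∀ i, shear K (e i) = Phi a b s i := by
    rintro (n | m)
    · rw [shear_apply, hinl, add_zero, he]
      rfl
    · rw [shear_apply, hinr, hK, he]
      change WithLp.toLp 2 (0 + phi₂₁L2 a b s m, cosInt m + 0) = Phi₂ a b s m
      rw [zero_add, add_zero]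
      rfl
  have hNe : ∀ i, upper N (e i) = 0 ∨
      ∃ (j : ℕ ⊕ ℕ) (c : ℝ), eig a b j = eig a b i ∧ upper N (e i) = c • e j := by
    rintro (n | m)
    · exact Or.inl (hinl N n)
    · rw [hinr, hN]
      by_cases h : m ∈ Delta₂ a b
      · refine Or.inr ⟨Sum.inl h.choose, -(√2 * s * muCoef m), ?_, ?_⟩
        · have := eig₂_sub_of_mem_Delta h.choose_spec
          change eig₁ a h.choose = eig₂ b m
          rw [eig₁]
          linarith
        · rw [resonance_of_mem s h, he]
          change _ = _ • WithLp.toLp 2 (cosHalf h.choose, 0)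
          rw [← WithLp.toLp_smul, Prod.smul_mk, smul_zero]
      · left
        rw [resonance_of_notMem s h]
        rfl
  have hT : ∀ i, (shear K (e i), shear K (eig a b i • e i + upper N (e i))) ∈
      (coupledOp a b s).graph := by
    rintro (n | m)
    · rw [hinl, add_zero, map_smul, hPhi]
      exact Phi₁_mem_graph a b s n
    · rw [map_add, map_smul, hPhi, hinr, hN, shear_apply, upper_apply]
      change (Phi₂ a b s m, WithLp.toLp 2 (eig₂ b m • phi₂₁L2 a b s m +
        (resonance a b s m + K 0), eig₂ b m • cosInt m + (0 + 0))) ∈ _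
      rw [map_zero, add_zero, add_zero, add_zero]
      exact Phi₂_mem_graph a b s m
  have hle : ∀ i, eig a b i ≤ max a b := by
    rintro (n | m)
    · exact (sub_le_self a (by positivity)).trans (le_max_left a b)
    · exact (sub_le_self b (by positivity)).trans (le_max_right a b)
  refine ⟨fun i => ?_, ⟨e, shear K, fun i => (hPhi i).symm⟩, ?_⟩
  · rw [← hPhi]
    exact isGeneralizedEigenvector_of_rieszBasis e hNe (upper_upper N N) (shear K) hT i
  · refine generatesC0Semigroup_of_rieszBasis e hle hNe (upper_upper N N) (shear K)
      (isClosed_coupledOp a b s) hT (lt_add_one (max a b)) fun u hu => ?_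
    exact eq_zero_of_mem_graph ((le_max_left a b).trans_lt (lt_add_one _))
      ((le_max_right a b).trans_lt (lt_add_one _)) hu
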